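/- Work over $\mathbb{C}$. A binary form of order $m\ge 0$ is a homogeneous polynomial of degree $m$ in $x_1,x_2$ with complex coefficients. For binary forms $A,B$ of orders $m,n$ and an integer $0\le r\le\min(m,n)$, the $r$-th transvectant of $A$ and $B$ is the binary form of order $m+n-2r$ $$(A,B)_r=\frac{(m-r)!\,(n-r)!}{m!\,n!}\sum_{i=0}^r(-1)^i\binom{r}{i}\,\frac{\partial^rA}{\partial x_1^{r-i}\,\partial x_2^{i}}\,\frac{\partial^rB}{\partial x_2^{r-i}\,\partial x_1^{i}} .$$ **Theorem 7.1 (recoupling formula for transvectants).** Let $A,B,C$ be binary forms of orders $a,b,c$, and let $r,s$ be integers with $0\le r\le\min(b,c)$ and $0\le s\le\min(a,\,b+c-2r)$. Put $$T_1=\frac{r!\,(b-r)!\,(c-r)!\,s!\,(a-s)!\,(b+c-2r-s)!}{(b+c-2r)!}$$ and, for $k\in\mathbb{Z}$, let $T_2(k)$ be $$\sum_{z}\frac{(-1)^z\,(z+1)!}{\begin{aligned}[t]&(z-a-b+k)!\,(z-b-c+r)!\,(z-a-b-c+2r+s)!\,(z-a-b-c+r+s+k)!\\&\times(a+b+c-r-s-z)!\,(a+b+c-r-k-z)!\,(a+2b+c-2r-s-k-z)!\end{aligned}}$$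 where the sum runs over all integers $z$ for which the arguments of the seven factorials in the denominator are nonnegative. Let $$\theta_k=(-1)^{a+b+c+r+s}\,T_1\,\frac{(a+b-2k+1)!\;T_2(k)}{(a+b-k+1)!\,(a+b+c-r-s-k+1)!}$$ if $\max(0,\,r+s-c)\le k\le\min(a,\,b,\,r+s,\,a+b-r-s)$, and $\theta_k=0$ otherwise. Then $$(A,(B,C)_r)_s=\sum_{k\in\mathbb{Z}}\theta_k\,((A,B)_k,C)_{r+s-k},$$ where the terms with $\theta_k=0$ are read as $0$ (for all other $k$ both transvectants in the term are defined). -/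

import Mathlib

open MvPolynomial
open scoped Nat

namespace BinaryForm

/-- `Form a A`: the polynomial `A` in the variables `x₁ = X 0`, `x₂ = X 1` over `ℂ` is a binary
form of order `a` (homogeneous of degree `a`; the zero form has every order). -/
def Form (a : ℕ) (A : MvPolynomial (Fin 2) ℂ) : Prop := A.IsHomogeneous a

/-- The mixed partial derivative `∂^(i+j) A / ∂x₁^i ∂x₂^j`. -/
noncomputable def mixedDeriv (i j : ℕ) (A : MvPolynomial (Fin 2) ℂ) : MvPolynomial (Fin 2) ℂ :=
  (pderiv (R := ℂ) (0 : Fin 2))^[i] ((pderiv (R := ℂ) (1 : Fin 2))^[j] A)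

/-- The `r`-th transvectant `(A, B)_r` of a binary form `A` of order `m` and a binary form `B` of
order `n`, meaningful for `r ≤ min m n`:
`(m-r)! (n-r)! / (m! n!) * ∑ i, (-1)^i (r choose i) *
  ∂^r A / (∂x₁^(r-i) ∂x₂^i) * ∂^r B / (∂x₂^(r-i) ∂x₁^i)`. -/
noncomputable def transvectant (m n r : ℕ) (A B : MvPolynomial (Fin 2) ℂ) :
    MvPolynomial (Fin 2) ℂ :=
  (((m - r)! : ℂ) * ((n - r)! : ℂ) / ((m ! : ℂ) * (n ! : ℂ))) •
    ∑ i ∈ Finset.range (r + 1),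
      ((-1 : ℂ) ^ i * (r.choose i : ℂ)) • (mixedDeriv (r - i) i A * mixedDeriv i (r - i) B)

/-- The factorial of an integer, as a complex number; only used at integers `≥ 0`. -/
noncomputable def zfact (n : ℤ) : ℂ := (n.toNat ! : ℂ)

/-- `T₁ = r! (b-r)! (c-r)! s! (a-s)! (b+c-2r-s)! / (b+c-2r)!`. -/
noncomputable def T₁ (a b c r s : ℤ) : ℂ :=
  zfact r * zfact (b - r) * zfact (c - r) * zfact s * zfact (a - s) * zfact (b + c - 2 * r - s) /
    zfact (b + c - 2 * r)

/-- The `z`-th term of `T₂ k`: it is `0` unless the arguments of the factorials in the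
denominator are all nonnegative. -/
noncomputable def T₂term (a b c r s k z : ℤ) : ℂ :=
  if 0 ≤ z - a - b + k ∧ 0 ≤ z - b - c + r ∧ 0 ≤ z - a - b - c + 2 * r + s ∧
      0 ≤ z - a - b - c + r + s + k ∧ 0 ≤ a + b + c - r - s - z ∧ 0 ≤ a + b + c - r - k - z ∧
      0 ≤ a + 2 * b + c - 2 * r - s - k - z then
    (-1 : ℂ) ^ z * zfact (z + 1) /
      (zfact (z - a - b + k) * zfact (z - b - c + r) * zfact (z - a - b - c + 2 * r + s) *
        zfact (z - a - b - c + r + s + k) * zfact (a + b + c - r - s - z) *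
        zfact (a + b + c - r - k - z) * zfact (a + 2 * b + c - 2 * r - s - k - z))
  else 0

/-- `T₂ k`, the sum over all integers `z` of the terms above (finitely many are nonzero). -/
noncomputable def T₂ (a b c r s k : ℤ) : ℂ := ∑ᶠ z : ℤ, T₂term a b c r s k z

/-- The recoupling coefficient `θ_k`. -/
noncomputable def θ (a b c r s k : ℤ) : ℂ :=
  if 0 ≤ k ∧ r + s - c ≤ k ∧ k ≤ a ∧ k ≤ a + b - r - s ∧ k ≤ b ∧ k ≤ r + s then
    (-1 : ℂ) ^ (a + b + c + r + s) * T₁ a b c r s *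
      (zfact (a + b - 2 * k + 1) * T₂ a b c r s k /
        (zfact (a + b - k + 1) * zfact (a + b + c - r - s - k + 1)))
  else 0

theorem T₂term_support_finite (a b c r s k : ℤ) :
    (Function.support (T₂term a b c r s k)).Finite := by
  refine (Set.finite_Icc (b + c - r) (a + b + c - r - s)).subset fun z hz => ?_
  by_contra h
  refine hz (if_neg fun h' => h ?_)
  rw [Set.mem_Icc]
  omega

theorem θ_support_finite (a b c r s : ℤ) : (Function.support (θ a b c r s)).Finite := by
  refine (Set.finite_Icc 0 a).subset fun k hk => ?_
  by_contra h
  refine hk (if_neg fun h' => h ?_)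
  rw [Set.mem_Icc]
  omega

end BinaryForm

/-!
# The recoupling formula for transvectants

Both sides are trilinear, and forms of order `m` are linear combinations of the powers
`(x₁ + t x₂) ^ m` (`Form.mem_span`), so it suffices to treat `A = α ^ a`, `B = β ^ b`, `C = γ ^ c`
with `α`, `β`, `γ` linear. For these, a transvectant with a power of a linear form is an iterated
directional derivative (`transvectant_lin_pow_right`, `transvectant_lin_pow_left`), and the iterated
transvectants become a common monomial times homogeneous polynomials of degree `n = r + s` in
`u = [αβ] γ`, `v = [αγ] β`, `w = [βγ] α`, which satisfy the Plücker relation `v = u + w`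
(`left_transvectant_lin_pow`, `right_transvectant_lin_pow`). Everything reduces to an identity
`leftPoly = ∑ θ_k rightPoly_k` in `u` and `w`.

By Vandermonde's convolution the coefficients of `u ^ p * w ^ (n - p)` are explicit products. After
rescaling, those of `rightPoly_k` form the triangular matrix `(N - k - p)! / (p - k)!` with
`N = a + b`, which has a closed inverse (`inverse_pair`). Hence `θ_k` must be a terminating balanced
`₄F₃(1)` series, and Whipple's transformation (`whipple`), which follows from two applications of
the Pfaff–Saalschütz sum (`saalschutz`), turns this series into the one defining `T₂`
(`θ_eq_sum_leftCoeff`). Both are stated division-free with rising factorials, so that they remain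
valid when parameters are nonpositive integers; the constraints on `z` in `T₂` are then
the vanishing of rising factorials that pass through `0`.

The inversion only covers `p ≤ K`, where `K = min (a, b, n, N - n)` is the largest `k` that occurs.
Beyond that, both polynomials are divisible by `v ^ (n - b)` (truncated subtraction) and have degree
at most `min (a, n)` in `u`; a difference divisible by `u ^ (K + 1)` and by `v ^ (n - b)` has too
large a degree to be nonzero (`leftCoeff_eq_sum`).
-/

namespace BinaryForm

/-! ### Rising factorials, Saalschütz and Whipple -/

theorem sum_triangle {M : Type*} [AddCommMonoid M] (n : ℕ) (F : ℕ → ℕ → M) :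
    ∑ m ∈ Finset.range (n + 1), ∑ i ∈ Finset.range (m + 1), F m i =
      ∑ i ∈ Finset.range (n + 1), ∑ j ∈ Finset.range (n - i + 1), F (i + j) i := by
  have h := Finset.sum_range_diag_flip (n + 1) fun i j => F (i + j) i
  trans ∑ m ∈ Finset.range (n + 1), ∑ i ∈ Finset.range (m + 1), F (i + (m - i)) i
  · refine Finset.sum_congr rfl fun m _ => Finset.sum_congr rfl fun i hi => ?_
    rw [Nat.add_sub_cancel' (Nat.lt_succ_iff.1 (Finset.mem_range.1 hi))]
  · rw [h]
    refine Finset.sum_congr rfl fun i hi => ?_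
    rw [Nat.sub_add_comm (Nat.lt_succ_iff.1 (Finset.mem_range.1 hi))]

/-- The rising factorial `x (x + 1) ⋯ (x + n - 1)`. -/
def rising {R : Type*} [CommRing R] (x : R) (n : ℕ) : R := ∏ j ∈ Finset.range n, (x + j)

section Rising

variable {R : Type*} [CommRing R]

@[simp] theorem rising_zero (x : R) : rising x 0 = 1 := by simp [rising]

theorem rising_succ (x : R) (n : ℕ) : rising x (n + 1) = rising x n * (x + n) := by
  simp [rising, Finset.prod_range_succ]

theorem rising_succ' (x : R) (n : ℕ) : rising x (n + 1) = x * rising (x + 1) n := by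
  rw [rising, Finset.prod_range_succ', mul_comm, rising]
  congr 1
  · simp
  · refine Finset.prod_congr rfl fun j _ => ?_
    push_cast
    ring

theorem rising_add (x : R) (m n : ℕ) : rising x (m + n) = rising x m * rising (x + m) n := by
  rw [rising, Finset.prod_range_add, rising, rising]
  congr 1
  refine Finset.prod_congr rfl fun j _ => ?_
  push_cast
  ring

/-- Reading a rising factorial backwards, with all factors negated. -/
theorem rising_reflect (x y : R) (n : ℕ) (h : x + y + n = 1) :
    rising x n = (-1) ^ n * rising y n := by
  have hpow : ((-1 : R)) ^ n = ∏ _j ∈ Finset.range n, (-1 : R) := by simp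
  rw [rising, ← Finset.prod_range_reflect, rising, hpow, ← Finset.prod_mul_distrib]
  refine Finset.prod_congr rfl fun j hj => ?_
  have hj' := Finset.mem_range.1 hj
  have : ((n - 1 - j : ℕ) : R) = n - 1 - j := by
    rw [Nat.cast_sub (by omega), Nat.cast_sub (by omega)]
    simp
  rw [this]
  linear_combination h

/-- The Pfaff–Saalschütz summation of a balanced terminating `₃F₂(1)`, cleared of denominators so
that it holds for all parameters in a commutative ring. -/
theorem saalschutz (A B C D : R) (hD : A + B + D = C) (m : ℕ) :
    ∑ i ∈ Finset.range (m + 1),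
      (m.choose i : R) * rising A i * rising B i * rising (C + i) (m - i) * rising D (m - i) =
      rising (C - A) m * rising (C - B) m := by
  induction m with
  | zero => simp
  | succ m ih =>
    -- the Wilf–Zeilberger companion of the summand
    let G : ℕ → R := fun i => match i with
      | 0 => 0
      | i + 1 => -((m.choose i : R) * rising A (i + 1) * rising B (i + 1) *
          rising (C + i) (m - i) * rising D (m - i))
    have key : ∀ i ∈ Finset.range (m + 1),
        ((m + 1).choose i : R) * rising A i * rising B i * rising (C + i) (m + 1 - i) *
            rising D (m + 1 - i) =
          (C - A + m) * (C - B + m) * ((m.choose i : R) * rising A i * rising B i *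
            rising (C + i) (m - i) * rising D (m - i)) + (G (i + 1) - G i) := by
      intro i hi
      have hi' : i ≤ m := Nat.lt_succ_iff.1 (Finset.mem_range.1 hi)
      obtain ⟨d, rfl⟩ := Nat.exists_eq_add_of_le hi'
      subst hD
      rcases i with _ | i
      · simp only [G]
        simp only [Nat.choose_zero_right, rising_succ, rising_zero, Nat.sub_zero]
        push_cast
        ring
      · have hc : ((i + 1 + d).choose i : R) * (d + 1) =
            ((i + 1 + d).choose (i + 1) : R) * (i + 1) := by
          have := Nat.choose_succ_right_eq (i + 1 + d) i
          have h2 : i + 1 + d - i = d + 1 := by omega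
          rw [h2] at this
          simpa using (congrArg (Nat.cast (R := R)) this).symm
        have e1 : i + 1 + d + 1 - (i + 1) = d + 1 := by omega
        have e2 : i + 1 + d - (i + 1) = d := by omega
        have e3 : i + 1 + d - i = d + 1 := by omega
        have e4 : ((i + 1 + d + 1).choose (i + 1) : R) =
            (i + 1 + d).choose i + (i + 1 + d).choose (i + 1) := by
          rw [Nat.choose_succ_succ]
          push_cast
          ring
        simp only [G, e1, e2, e3, e4]
        have e5 : rising (A + B + D + (i : R)) (d + 1) =
            (A + B + D + i) * rising (A + B + D + ((i + 1 : ℕ) : R)) d := by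
          rw [rising_succ']
          push_cast
          ring_nf
        rw [e5, rising_succ A (i + 1), rising_succ B (i + 1), rising_succ D d,
          rising_succ (A + B + D + ((i + 1 : ℕ) : R)) d]
        generalize rising (A + B + D + ((i + 1 : ℕ) : R)) d = Y
        push_cast
        linear_combination (rising A (i + 1)) * (rising B (i + 1)) * Y * (rising D d) *
          (D + d) * hc
    rw [Finset.sum_range_succ, Finset.sum_congr rfl key, Finset.sum_add_distrib, ← Finset.mul_sum,
      ih, Finset.sum_range_sub, rising_succ (C - A), rising_succ (C - B)]
    simp only [G]
    simp
    ring

/-- Whipple's transformation of a balanced terminating `₄F₃(1)`, cleared of denominators. -/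
theorem whipple (M : ℕ) (a b c d e f : R) (h : e + f + d + M = 1 + a + b + c) :
    ∑ m ∈ Finset.range (M + 1),
      (M.choose m : R) * (-1) ^ m * rising a m * rising b m * rising c m *
        rising (d + m) (M - m) * rising (e + m) (M - m) * rising (f + m) (M - m) =
    ∑ i ∈ Finset.range (M + 1),
      (M.choose i : R) * (-1) ^ i * rising a i * rising (d - b) i * rising (d - c) i *
        rising (d + i) (M - i) * rising (e - a) (M - i) * rising (f - a) (M - i) := by
  -- Saalschütz splits `(b)_m (c)_m` into a sum over `i`; after exchanging the two sums, the one
  -- over `m` is again of Saalschütz type because the series is balanced.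
  have h1 : ∀ m ∈ Finset.range (M + 1),
      (M.choose m : R) * (-1) ^ m * rising a m * rising b m * rising c m *
        rising (d + m) (M - m) * rising (e + m) (M - m) * rising (f + m) (M - m) =
      ∑ i ∈ Finset.range (m + 1), (M.choose m : R) * (-1) ^ m * rising a m *
        ((m.choose i : R) * rising (d - b) i * rising (d - c) i * rising (d + i) (m - i) *
          rising (b + c - d) (m - i)) *
        rising (d + m) (M - m) * rising (e + m) (M - m) * rising (f + m) (M - m) := by
    intro m _
    have := saalschutz (d - b) (d - c) d (b + c - d) (by ring) m
    rw [sub_sub_cancel, sub_sub_cancel] at this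
    simp only [← Finset.sum_mul, ← Finset.mul_sum]
    rw [this]
    ring
  rw [Finset.sum_congr rfl h1, sum_triangle]
  refine Finset.sum_congr rfl fun i hi => ?_
  have hi' : i ≤ M := Nat.lt_succ_iff.1 (Finset.mem_range.1 hi)
  have h2 := saalschutz (a + i) (b + c - d) (e + i) (e - a - (b + c - d)) (by ring) (M - i)
  have e0 : e + (i : R) - (a + i) = e - a := by ring
  have h3 : (M.choose i : R) * (-1) ^ i * rising a i * rising (d - b) i * rising (d - c) i *
        rising (d + i) (M - i) * rising (e - a) (M - i) * rising (f - a) (M - i) =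
      (M.choose i : R) * (-1) ^ i * rising a i * rising (d - b) i * rising (d - c) i *
        rising (d + i) (M - i) * (-1) ^ (M - i) *
          (rising (e - a) (M - i) * rising (e + i - (b + c - d)) (M - i)) := by
    rw [rising_reflect (f - a) (e + i - (b + c - d)) (M - i)
      (by push_cast [Nat.cast_sub hi']; linear_combination h)]
    ring
  rw [e0] at h2
  rw [h3, ← h2, Finset.mul_sum]
  refine Finset.sum_congr rfl fun j hj => ?_
  obtain ⟨l, rfl⟩ := Nat.exists_eq_add_of_le (show i + j ≤ M by
    have := Finset.mem_range.1 hj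
    omega)
  have e1 : i + j - i = j := by omega
  have e2 : i + j + l - (i + j) = l := by omega
  have e3 : i + j + l - i = j + l := by omega
  have e4 : j + l - j = l := by omega
  simp only [e1, e2, e3, e4]
  have hc : ((i + j + l).choose (i + j) : R) * ((i + j).choose i : R) =
      ((i + j + l).choose i : R) * ((j + l).choose j : R) := by
    have := Nat.choose_mul (n := i + j + l) (k := i + j) (s := i)
    rw [e1, e3] at this
    simpa using congrArg (Nat.cast (R := R)) (this (by omega))
  rw [rising_add a i j, rising_add (d + i) j l,
    rising_reflect (f + ((i + j : ℕ) : R)) (e - a - (b + c - d)) l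
      (by push_cast at h ⊢; linear_combination h)]
  have e5 : d + (i : R) + j = d + ((i + j : ℕ) : R) := by push_cast; ring
  have e6 : e + (i : R) + j = e + ((i + j : ℕ) : R) := by push_cast; ring
  rw [e5, e6]
  rw [pow_add, pow_add]
  linear_combination ((-1) ^ i * (-1) ^ j * (-1) ^ l * rising a i * rising (a + i) j *
    rising (d - b) i * rising (d - c) i * rising (d + i) j * rising (d + ((i + j : ℕ) : R)) l *
    rising (b + c - d) j * rising (e + ((i + j : ℕ) : R)) l *
    rising (e - a - (b + c - d)) l) * hc

end Rising

/-! ### The coefficients `θ_k` as a transformed hypergeometric series -/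

/-- The reciprocal factorial of an integer, which is `0` at negative integers. -/
noncomputable def invFact (z : ℤ) : ℂ := if 0 ≤ z then (zfact z)⁻¹ else 0

theorem zfact_natCast (n : ℕ) : zfact (n : ℤ) = (n ! : ℂ) := by simp [zfact]

theorem zfact_of_eq {z : ℤ} {n : ℕ} (h : z = n) : zfact z = (n ! : ℂ) := by
  rw [h, zfact_natCast]

theorem invFact_of_eq {z : ℤ} {n : ℕ} (h : z = n) : invFact z = ((n ! : ℕ) : ℂ)⁻¹ := by
  rw [invFact, if_pos (by omega), h, zfact_natCast]

theorem invFact_of_neg {z : ℤ} (h : z < 0) : invFact z = 0 := if_neg (by omega)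

theorem factorial_cast_ne_zero (n : ℕ) : ((n ! : ℕ) : ℂ) ≠ 0 :=
  Nat.cast_ne_zero.2 n.factorial_ne_zero

theorem cast_choose_eq (M i : ℕ) :
    (M.choose i : ℂ) = M ! * (i ! : ℂ)⁻¹ * invFact (M - i) := by
  rcases le_or_gt i M with h | h
  · rw [invFact_of_eq (n := M - i) (by omega), Nat.cast_choose ℂ h]
    have := factorial_cast_ne_zero i
    have := factorial_cast_ne_zero (M - i)
    field_simp
  · rw [invFact_of_neg (by omega), Nat.choose_eq_zero_of_lt h]
    simp

/-- Rising factorials at an integer, including those that pass through `0`. -/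
theorem rising_intCast (y : ℤ) (m w : ℕ) (h : y + m = w) :
    rising ((y : ℂ) + 1) m = w ! * invFact y := by
  rcases lt_or_ge y 0 with hy | hy
  · rw [invFact_of_neg hy, mul_zero, rising]
    refine Finset.prod_eq_zero (i := (-y - 1).toNat) (Finset.mem_range.2 (by omega)) ?_
    have : ((((-y - 1).toNat : ℕ) : ℤ) : ℂ) = ((-y - 1 : ℤ) : ℂ) := by
      congr 1
      omega
    rw [Int.cast_natCast] at this
    rw [this]
    push_cast
    ring
  · lift y to ℕ using hy
    have hw : w = y + m := by omega
    subst hw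
    rw [invFact_of_eq rfl]
    induction m with
    | zero => simp [mul_inv_cancel₀ (factorial_cast_ne_zero y)]
    | succ m ih =>
      rw [rising_succ, ih (by push_cast; ring), ← add_assoc, Nat.factorial_succ]
      push_cast
      ring

theorem rising_neg_natCast (x m : ℕ) :
    rising (-(x : ℂ)) m = (-1) ^ m * (x ! * invFact (x - m)) := by
  rw [rising_reflect _ (((x - m : ℤ) : ℂ) + 1) m (by push_cast; ring),
    rising_intCast (x - m) m x (by ring)]

/-- `T₂` with its terms written through reciprocal factorials, and `z` counted from its lower bound
`a + b + c - r - s - k`. The remaining constraints on `z` are absorbed by `invFact`. -/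
theorem T₂_eq_sum (a b c r s k : ℕ) (hk : k + (r + s) ≤ a + b + c) :
    T₂ a b c r s k = ∑ i ∈ Finset.range (k + 1),
      (-1 : ℂ) ^ (a + b + c + r + s + k + i) * ((a + b + c - (r + s) - k + 1 + i)! : ℂ) *
        ((i ! : ℂ)⁻¹ * ((k - i)! : ℂ)⁻¹ * invFact (c - (r + s) + i) * invFact (a - s - k + i) *
          invFact (r - k + i) * invFact (s - i) * invFact (b - r - i)) := by
  have hinj : Function.Injective fun i : ℕ => (a + b + c - r - s - k : ℤ) + i :=
    fun i j h => by simpa using h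
  rw [T₂, finsum_eq_sum_of_support_subset (s := (Finset.range (k + 1)).map ⟨_, hinj⟩),
    Finset.sum_map]
  · refine Finset.sum_congr rfl fun i hi => ?_
    have hik : i ≤ k := Nat.lt_succ_iff.1 (Finset.mem_range.1 hi)
    obtain ⟨j, rfl⟩ := Nat.exists_eq_add_of_le hik
    simp only [Function.Embedding.coeFn_mk]
    rw [T₂term]
    have hsign : (-1 : ℂ) ^ ((a + b + c - r - s - ((i + j : ℕ) : ℤ) : ℤ) + i) =
        (-1 : ℂ) ^ (a + b + c + r + s + (i + j) + i) := by
      rw [← zpow_natCast]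
      have : ((a + b + c + r + s + (i + j) + i : ℕ) : ℤ) =
          ((a + b + c - r - s - ((i + j : ℕ) : ℤ) : ℤ) + i) + 2 * (r + s + (i + j)) := by
        push_cast
        ring
      rw [this, zpow_add₀ (by norm_num) _ (2 * _), zpow_mul]
      norm_num
    split_ifs with h
    · rw [hsign, zfact_of_eq (n := a + b + c - (r + s) - (i + j) + 1 + i) (by omega)]
      simp only [invFact]
      rw [if_pos (by omega), if_pos (by omega), if_pos (by omega), if_pos (by omega),
        if_pos (by omega)]
      have h1 : ((i ! : ℕ) : ℂ) = zfact ((a + b + c - r - s - ((i + j : ℕ) : ℤ) : ℤ) + i - a - b - c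
        + r + s + ((i + j : ℕ) : ℤ)) := (zfact_of_eq (by omega)).symm
      have h2 : (((i + j - i)! : ℕ) : ℂ) = zfact (a + b + c - r - s -
        ((a + b + c - r - s - ((i + j : ℕ) : ℤ) : ℤ) + i)) := (zfact_of_eq (by omega)).symm
      rw [h1, h2, div_eq_mul_inv, mul_inv, mul_inv, mul_inv, mul_inv, mul_inv, mul_inv]
      have e1 : (a + b + c - r - s - ((i + j : ℕ) : ℤ) : ℤ) + i - a - b + ((i + j : ℕ) : ℤ) =
        c - (r + s) + i := by ring
      have e2 : (a + b + c - r - s - ((i + j : ℕ) : ℤ) : ℤ) + i - b - c + r =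
        a - s - ((i + j : ℕ) : ℤ) + i := by ring
      have e3 : (a + b + c - r - s - ((i + j : ℕ) : ℤ) : ℤ) + i - a - b - c + 2 * r + s =
        r - ((i + j : ℕ) : ℤ) + i := by ring
      have e4 : a + b + c - r - ((i + j : ℕ) : ℤ) -
          ((a + b + c - r - s - ((i + j : ℕ) : ℤ) : ℤ) + i) = s - i := by ring
      have e5 : a + 2 * b + c - 2 * r - s - ((i + j : ℕ) : ℤ) -
        ((a + b + c - r - s - ((i + j : ℕ) : ℤ) : ℤ) + i) = b - r - i := by ring
      rw [e1, e2, e3, e4, e5]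
      ring
    · symm
      rw [mul_eq_zero]
      right
      have : (c - (r + s) + i : ℤ) < 0 ∨ (a - s - ((i + j : ℕ) : ℤ) + i : ℤ) < 0 ∨
          (r - ((i + j : ℕ) : ℤ) + i : ℤ) < 0 ∨ (s - i : ℤ) < 0 ∨ (b - r - i : ℤ) < 0 := by
        omega
      rcases this with h | h | h | h | h <;> rw [invFact_of_neg h] <;> simp
  · intro z hz
    rw [Function.mem_support, T₂term] at hz
    have h := (ite_ne_right_iff.1 hz).1
    simp only [Finset.coe_map, Set.mem_image, Finset.coe_range, Set.mem_Iio,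
      Function.Embedding.coeFn_mk]
    exact ⟨(z - (a + b + c - r - s - k)).toNat, by omega, by omega⟩

/-- Coefficient of `u ^ p * w ^ (r + s - p)` in the expansion of `(A, (B, C)_r)_s` for powers of
linear forms, up to a common monomial, where `u = [αβ] γ` and `w = [βγ] α`. -/
noncomputable def leftCoeff (b c r s p : ℕ) : ℂ :=
  if p ≤ s then ((c - r).choose (s - p) : ℂ) * ((b + c - 2 * r - s + p).choose p : ℂ) /
    ((b + c - 2 * r).choose s : ℂ) else 0

theorem leftCoeff_eq {b c r s : ℕ} (hrc : r ≤ c) (hs : s ≤ b + c - 2 * r) (p : ℕ) :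
    leftCoeff b c r s p = (c - r)! * s ! * (b + c - 2 * r - s + p)! /
      (p ! * (b + c - 2 * r)!) * (invFact (s - p) * invFact (c - (r + s) + p)) := by
  rw [leftCoeff]
  have f1 := factorial_cast_ne_zero p
  have f2 := factorial_cast_ne_zero (b + c - 2 * r)
  have f3 := factorial_cast_ne_zero (b + c - 2 * r - s)
  have f4 := factorial_cast_ne_zero s
  split_ifs with hp
  · have e : ((c - r : ℕ) : ℤ) - ((s - p : ℕ) : ℤ) = c - (r + s) + p := by omega
    rw [cast_choose_eq (c - r), cast_choose_eq (b + c - 2 * r - s + p), cast_choose_eq _ s, e,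
      invFact_of_eq (z := s - p) (n := s - p) (by omega),
      invFact_of_eq (n := b + c - 2 * r - s)
        (z := ((b + c - 2 * r - s + p : ℕ) : ℤ) - p) (by omega),
      invFact_of_eq (n := b + c - 2 * r - s) (z := ((b + c - 2 * r : ℕ) : ℤ) - s) (by omega)]
    have f5 := factorial_cast_ne_zero (s - p)
    field_simp
  · rw [invFact_of_neg (by omega)]
    simp

/-- The constant relating both sides of Whipple's transformation to the rescaled `θ_k`. -/
noncomputable def whippleScale (a b c r s k : ℕ) : ℂ :=
  (-1) ^ k * ((a + b - 2 * k : ℕ) + 1 : ℂ) * (c - r)! * (b + c - 2 * r - s)! *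
    (r + s - k)! * (a - k)! / ((b + c - 2 * r)! * k ! * (a + b - k + 1)! * (c + k - (r + s))!)

/-- The terms of the inverted series for `θ_k` are those of the left side of `whipple` with
`M = k`. -/
theorem leftCoeff_eq_whipple_term {a b c r s k m : ℕ} (hrc : r ≤ c)
    (hs : s ≤ b + c - 2 * r) (hka : k ≤ a) (hkn : k ≤ r + s)
    (hkN : k + (r + s) ≤ a + b) (hc : r + s ≤ c + k) (hmk : m ≤ k) :
    (-1 : ℂ) ^ (k - m) * ((a + b - 2 * k : ℕ) + 1 : ℂ) / ((k - m)! * (a + b - k - m + 1)!) *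
        (leftCoeff b c r s m * ((a - m)! * (r + s - m)!)) =
      whippleScale a b c r s k * ((k.choose m : ℂ) * (-1) ^ m * rising (-(s : ℂ)) m *
        rising (-((a + b - k + 1 : ℕ) : ℂ)) m *
        rising ((((b + c - 2 * r - s : ℕ) : ℤ) : ℂ) + 1) m *
        rising ((((c - (r + s) : ℤ) : ℂ) + 1) + m) (k - m) *
        rising (-((r + s : ℕ) : ℂ) + m) (k - m) * rising (-(a : ℂ) + m) (k - m)) := by
  have c1 : (((c - (r + s) : ℤ) : ℂ) + 1) + m = (((c - (r + s) + m : ℤ)) : ℂ) + 1 := by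
    push_cast
    ring
  have c2 : -((r + s : ℕ) : ℂ) + m = -((r + s - m : ℕ) : ℂ) := by
    rw [Nat.cast_sub (show m ≤ r + s by omega)]
    ring
  have c3 : -(a : ℂ) + m = -((a - m : ℕ) : ℂ) := by
    rw [Nat.cast_sub (by omega)]
    ring
  rw [c1, c2, c3, rising_neg_natCast, rising_neg_natCast, rising_neg_natCast, rising_neg_natCast,
    rising_intCast _ m (b + c - 2 * r - s + m) (by push_cast; ring),
    rising_intCast _ (k - m) (c + k - (r + s)) (by omega),
    leftCoeff_eq hrc hs, cast_choose_eq,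
    invFact_of_eq (z := (k : ℤ) - m) (n := k - m) (by omega),
    invFact_of_eq (z := ((b + c - 2 * r - s : ℕ) : ℤ)) rfl,
    invFact_of_eq (z := ((a + b - k + 1 : ℕ) : ℤ) - m) (n := a + b - k - m + 1) (by omega),
    invFact_of_eq (z := ((r + s - m : ℕ) : ℤ) - (k - m : ℕ)) (n := r + s - k) (by omega),
    invFact_of_eq (z := ((a - m : ℕ) : ℤ) - (k - m : ℕ)) (n := a - k) (by omega), whippleScale]
  have f1 := factorial_cast_ne_zero m
  have f2 := factorial_cast_ne_zero (b + c - 2 * r)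
  have f3 := factorial_cast_ne_zero (b + c - 2 * r - s)
  have f4 := factorial_cast_ne_zero (k - m)
  have f5 := factorial_cast_ne_zero (a + b - k - m + 1)
  have f6 := factorial_cast_ne_zero (r + s - k)
  have f7 := factorial_cast_ne_zero (a - k)
  have f8 := factorial_cast_ne_zero k
  have f9 := factorial_cast_ne_zero (a + b - k + 1)
  have f10 := factorial_cast_ne_zero (c + k - (r + s))
  obtain ⟨j, rfl⟩ := Nat.exists_eq_add_of_le hmk
  have e1 : m + j - m = j := by omega
  rw [e1] at f4 ⊢
  have s1 : ((-1 : ℂ) ^ m * (-1) ^ m) = 1 := by rw [← mul_pow]; norm_num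
  have s2 : ((-1 : ℂ) ^ j * (-1) ^ j) = 1 := by rw [← mul_pow]; norm_num
  rw [pow_add (-1 : ℂ) m j]
  generalize (-1 : ℂ) ^ m = x at s1 ⊢
  generalize (-1 : ℂ) ^ j = y at s2 ⊢
  have s3 : x * y * (x * x * x * (y * y)) = y := by
    linear_combination (x ^ 2 * y ^ 3 + y ^ 3) * s1 + y * s2
  -- what is left is an identity between monomials in a field
  clear c1 c2 c3
  generalize invFact (s - m) = I1
  generalize invFact (c - (r + s) + m) = I2
  generalize ((a + b - 2 * (m + j) : ℕ) + 1 : ℂ) = E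
  generalize (((a + b - (m + j) - m + 1)! : ℕ) : ℂ) = F5 at *
  generalize (((r + s - m)! : ℕ) : ℂ) = Rm
  generalize (((a - m)! : ℕ) : ℂ) = Am
  generalize (((b + c - 2 * r - s + m)! : ℕ) : ℂ) = Bm
  generalize (((b + c - 2 * r - s)! : ℕ) : ℂ) = B0 at *
  generalize (((b + c - 2 * r)! : ℕ) : ℂ) = B2 at *
  generalize (((r + s - (m + j))! : ℕ) : ℂ) = R6 at *
  generalize (((a - (m + j))! : ℕ) : ℂ) = A7 at *
  generalize (((a + b - (m + j) + 1)! : ℕ) : ℂ) = F9 at *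
  generalize (((c + (m + j) - (r + s))! : ℕ) : ℂ) = F10 at *
  generalize (((m + j)! : ℕ) : ℂ) = Kf at *
  generalize ((m ! : ℕ) : ℂ) = Mf at *
  generalize ((j ! : ℕ) : ℂ) = Jf at *
  generalize ((s ! : ℕ) : ℂ) = Sf at *
  generalize (((c - r)! : ℕ) : ℂ) = Cr at *
  have : y * E / (Jf * F5) * (Cr * Sf * Bm / (Mf * B2) * (I1 * I2) * (Am * Rm)) =
      (x * y * (x * x * x * (y * y))) * (E * Cr * Sf * Bm * I1 * I2 * Am * Rm) /
        (Jf * F5 * Mf * B2) := by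
    rw [s3]
    field_simp
  rw [this]
  trans x * y * (x * x * x * (y * y)) * (E * Cr * Sf * Bm * I1 * I2 * Am * Rm) /
    (Jf * F5 * Mf * B2) * (Kf * Kf⁻¹) * (B0 * B0⁻¹) * (R6 * R6⁻¹) * (A7 * A7⁻¹) * (F9 * F9⁻¹) *
      (F10 * F10⁻¹)
  · rw [mul_inv_cancel₀ f8, mul_inv_cancel₀ f3, mul_inv_cancel₀ f6, mul_inv_cancel₀ f7,
      mul_inv_cancel₀ f9, mul_inv_cancel₀ f10]
    simp only [mul_one]
  · ring

/-- The terms of `θ_k`, with `T₂` expanded, are those of the right side of `whipple` with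
`M = k`. -/
theorem T₂_term_eq_whipple_term {a b c r s k i : ℕ} (hrb : r ≤ b) (hrc : r ≤ c) (hsa : s ≤ a)
    (hs : s ≤ b + c - 2 * r) (hka : k ≤ a) (hkb : k ≤ b)
    (hkN : k + (r + s) ≤ a + b) (hc : r + s ≤ c + k) (hik : i ≤ k) :
    (-1 : ℂ) ^ ((a : ℤ) + b + c + r + s) * ((r ! : ℂ) * (b - r)! * (c - r)! * s ! * (a - s)! *
        (b + c - 2 * r - s)! / (b + c - 2 * r)!) *
      ((a + b - 2 * k + 1)! * ((-1 : ℂ) ^ (a + b + c + r + s + k + i) *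
        ((a + b + c - (r + s) - k + 1 + i)! : ℂ) *
        ((i ! : ℂ)⁻¹ * ((k - i)! : ℂ)⁻¹ * invFact (c - (r + s) + i) * invFact (a - s - k + i) *
          invFact (r - k + i) * invFact (s - i) * invFact (b - r - i))) /
        ((a + b - k + 1)! * (a + b + c - (r + s) - k + 1)!)) *
      ((a - k)! * (r + s - k)! / (a + b - 2 * k)!) =
    whippleScale a b c r s k * ((k.choose i : ℂ) * (-1) ^ i * rising (-(s : ℂ)) i *
        rising ((((c - (r + s) : ℤ) : ℂ) + 1) - -((a + b - k + 1 : ℕ) : ℂ)) i *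
        rising ((((c - (r + s) : ℤ) : ℂ) + 1) - ((((b + c - 2 * r - s : ℕ) : ℤ) : ℂ) + 1)) i *
        rising ((((c - (r + s) : ℤ) : ℂ) + 1) + i) (k - i) *
        rising (-((r + s : ℕ) : ℂ) - -(s : ℂ)) (k - i) * rising (-(a : ℂ) - -(s : ℂ)) (k - i)) := by
  have c1 : (((c - (r + s) : ℤ) : ℂ) + 1) + i = (((c - (r + s) + i : ℤ)) : ℂ) + 1 := by
    push_cast
    ring
  have c2 : (((c - (r + s) : ℤ) : ℂ) + 1) - -((a + b - k + 1 : ℕ) : ℂ) =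
      (((a + b + c - (r + s) - k + 1 : ℕ) : ℤ) : ℂ) + 1 := by
    have h1 : ((a + b - k + 1 : ℕ) : ℂ) = ((a + b - k + 1 : ℤ) : ℂ) := by
      have : ((a + b - k + 1 : ℕ) : ℤ) = a + b - k + 1 := by omega
      rw [← this, Int.cast_natCast]
    have h2 : ((a + b + c - (r + s) - k + 1 : ℕ) : ℤ) = a + b + c - (r + s) - k + 1 := by omega
    rw [h1, h2]
    push_cast
    ring
  have c3 : (((c - (r + s) : ℤ) : ℂ) + 1) - ((((b + c - 2 * r - s : ℕ) : ℤ) : ℂ) + 1) =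
      -((b - r : ℕ) : ℂ) := by
    have h2 : ((b + c - 2 * r - s : ℕ) : ℤ) = b + c - 2 * r - s := by omega
    rw [h2, Nat.cast_sub hrb]
    push_cast
    ring
  have c4 : -((r + s : ℕ) : ℂ) - -(s : ℂ) = -(r : ℂ) := by
    push_cast
    ring
  have c5 : -(a : ℂ) - -(s : ℂ) = -((a - s : ℕ) : ℂ) := by
    rw [Nat.cast_sub hsa]
    ring
  have d1 : ((r : ℤ) - (k - i : ℕ)) = r - k + i := by omega
  have d2 : (((a - s : ℕ) : ℤ) - (k - i : ℕ)) = a - s - k + i := by omega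
  have d3 : (((b - r : ℕ) : ℤ) - i) = b - r - i := by omega
  rw [c1, c2, c3, c4, c5, rising_neg_natCast, rising_neg_natCast, rising_neg_natCast,
    rising_neg_natCast,
    rising_intCast _ i (a + b + c - (r + s) - k + 1 + i) (by push_cast; ring),
    rising_intCast _ (k - i) (c + k - (r + s)) (by omega),
    cast_choose_eq, d1, d2, d3,
    invFact_of_eq (z := (k : ℤ) - i) (n := k - i) (by omega),
    invFact_of_eq (z := ((a + b + c - (r + s) - k + 1 : ℕ) : ℤ)) rfl, whippleScale,
    Nat.factorial_succ (a + b - 2 * k)]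
  have f1 := factorial_cast_ne_zero (a + b - 2 * k)
  have f2 := factorial_cast_ne_zero (b + c - 2 * r)
  have f3 := factorial_cast_ne_zero (a + b + c - (r + s) - k + 1)
  have f4 := factorial_cast_ne_zero (k - i)
  have f5 := factorial_cast_ne_zero i
  have f8 := factorial_cast_ne_zero k
  have f9 := factorial_cast_ne_zero (a + b - k + 1)
  have f10 := factorial_cast_ne_zero (c + k - (r + s))
  obtain ⟨j, rfl⟩ := Nat.exists_eq_add_of_le hik
  have e1 : i + j - i = j := by omega
  rw [e1] at f4 ⊢
  have s0 : (-1 : ℂ) ^ ((a : ℤ) + b + c + r + s) = (-1 : ℂ) ^ (a + b + c + r + s) := by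
    rw [← zpow_natCast]
    push_cast
    rfl
  rw [s0, add_assoc (a + b + c + r + s), pow_add (-1 : ℂ) (a + b + c + r + s),
    pow_add (-1 : ℂ) (i + j) i, pow_add (-1 : ℂ) i j]
  have s1 : ((-1 : ℂ) ^ i * (-1) ^ i) = 1 := by rw [← mul_pow]; norm_num
  have s2 : ((-1 : ℂ) ^ j * (-1) ^ j) = 1 := by rw [← mul_pow]; norm_num
  have s3 : ((-1 : ℂ) ^ (a + b + c + r + s) * (-1) ^ (a + b + c + r + s)) = 1 := by
    rw [← mul_pow]
    norm_num
  rw [Nat.cast_mul, Nat.cast_succ]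
  -- what is left is an identity between monomials in a field
  clear c1 c2 c3 c4 c5 d1 d2 d3
  generalize (-1 : ℂ) ^ i = x at *
  generalize (-1 : ℂ) ^ j = y at *
  generalize (-1 : ℂ) ^ (a + b + c + r + s) = w at *
  generalize invFact (s - i) = I1
  generalize invFact (c - (r + s) + i) = I2
  generalize invFact (a - s - (i + j : ℕ) + i) = I3
  generalize invFact (r - (i + j : ℕ) + i) = I4
  generalize invFact (b - r - i) = I5
  generalize ((a + b - 2 * (i + j) : ℕ) + 1 : ℂ) = E
  generalize (((a + b - 2 * (i + j))! : ℕ) : ℂ) = N0 at *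
  generalize (((a + b + c - (r + s) - (i + j) + 1 + i)! : ℕ) : ℂ) = Z at *
  generalize (((a + b + c - (r + s) - (i + j) + 1)! : ℕ) : ℂ) = Z0 at *
  generalize (((b + c - 2 * r - s)! : ℕ) : ℂ) = B0 at *
  generalize (((b + c - 2 * r)! : ℕ) : ℂ) = B2 at *
  generalize (((r + s - (i + j))! : ℕ) : ℂ) = R6 at *
  generalize (((a - (i + j))! : ℕ) : ℂ) = A7 at *
  generalize (((a + b - (i + j) + 1)! : ℕ) : ℂ) = F9 at *
  generalize (((c + (i + j) - (r + s))! : ℕ) : ℂ) = F10 at *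
  generalize (((i + j)! : ℕ) : ℂ) = Kf at *
  generalize ((i ! : ℕ) : ℂ) = If at *
  generalize ((j ! : ℕ) : ℂ) = Jf at *
  generalize ((s ! : ℕ) : ℂ) = Sf at *
  generalize ((r ! : ℕ) : ℂ) = Rf at *
  generalize (((c - r)! : ℕ) : ℂ) = Cr at *
  generalize (((b - r)! : ℕ) : ℂ) = Br at *
  generalize (((a - s)! : ℕ) : ℂ) = As at *
  trans (w * w * (x * x) * y * (Rf * Br * Cr * Sf * As * B0 * E * Z * R6 * A7 *
      I1 * I2 * I3 * I4 * I5)) / (B2 * F9 * Z0 * If * Jf)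
  · trans (w * w * (x * x) * y * (Rf * Br * Cr * Sf * As * B0 * E * Z * R6 * A7 *
      I1 * I2 * I3 * I4 * I5)) / (B2 * F9 * Z0 * If * Jf) * (N0 * N0⁻¹)
    · ring
    · rw [mul_inv_cancel₀ f1, mul_one]
  · rw [s3]
    trans (y * (x * x) * (x * x) * (y * y) * (Rf * Br * Cr * Sf * As * B0 * E * Z * R6 * A7 *
      I1 * I2 * I3 * I4 * I5)) / (B2 * F9 * Z0 * If * Jf) * (Kf * Kf⁻¹) * (F10 * F10⁻¹)
    · rw [s1, s2, mul_inv_cancel₀ f8, mul_inv_cancel₀ f10]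
      ring
    · ring

/-- The coefficient `θ_k`, rescaled, is the image of the rescaled coefficients `leftCoeff` under
the inverse of the triangular matrix `(N - k - p)! / (p - k)!`, `N = a + b`. This is Whipple's
transformation. -/
theorem θ_eq_sum_leftCoeff {a b c r s k : ℕ} (hrb : r ≤ b) (hrc : r ≤ c) (hsa : s ≤ a)
    (hs : s ≤ b + c - 2 * r) (hka : k ≤ a) (hkb : k ≤ b) (hkn : k ≤ r + s)
    (hkN : k + (r + s) ≤ a + b) :
    θ a b c r s k * ((a - k)! * (r + s - k)! / (a + b - 2 * k)! : ℂ) =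
      ∑ m ∈ Finset.range (k + 1), (-1 : ℂ) ^ (k - m) * ((a + b - 2 * k : ℕ) + 1 : ℂ) /
        ((k - m)! * (a + b - k - m + 1)!) *
        (leftCoeff b c r s m * ((a - m)! * (r + s - m)!)) := by
  rcases lt_or_ge (c + k) (r + s) with hc | hc
  -- If `k < r + s - c`, then `θ_k = 0` by definition, and so is every term of the sum.
  · rw [θ, if_neg (by omega), zero_mul]
    symm
    refine Finset.sum_eq_zero fun m hm => ?_
    have := Finset.mem_range.1 hm
    rw [leftCoeff_eq hrc hs, invFact_of_neg (z := c - (r + s) + m) (by omega)]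
    ring
  have hW := whipple k (-(s : ℂ)) (-((a + b - k + 1 : ℕ) : ℂ))
    ((((b + c - 2 * r - s : ℕ) : ℤ) : ℂ) + 1) (((c - (r + s) : ℤ) : ℂ) + 1)
    (-((r + s : ℕ) : ℂ)) (-(a : ℂ)) (by
      have h1 : ((a + b - k + 1 : ℕ) : ℂ) = a + b - k + 1 := by
        rw [Nat.cast_add, Nat.cast_sub (by omega)]
        push_cast
        ring
      have h2 : ((((b + c - 2 * r - s : ℕ) : ℤ)) : ℂ) = b + c - 2 * r - s := by
        have : ((b + c - 2 * r - s : ℕ) : ℤ) = b + c - 2 * r - s := by omega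
        rw [this]
        push_cast
        ring
      rw [h1, h2]
      push_cast
      ring)
  rw [Finset.sum_congr rfl fun m hm => leftCoeff_eq_whipple_term hrc hs hka hkn hkN hc
    (Nat.lt_succ_iff.1 (Finset.mem_range.1 hm)), ← Finset.mul_sum, hW]
  rw [θ, if_pos (by omega), T₂_eq_sum a b c r s k (by omega), T₁]
  rw [zfact_of_eq (z := r) (n := r) rfl, zfact_of_eq (z := b - r) (n := b - r) (by omega),
    zfact_of_eq (z := c - r) (n := c - r) (by omega), zfact_of_eq (z := s) (n := s) rfl,
    zfact_of_eq (z := a - s) (n := a - s) (by omega),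
    zfact_of_eq (z := b + c - 2 * r - s) (n := b + c - 2 * r - s) (by omega),
    zfact_of_eq (z := b + c - 2 * r) (n := b + c - 2 * r) (by omega),
    zfact_of_eq (z := a + b - 2 * k + 1) (n := a + b - 2 * k + 1) (by omega),
    zfact_of_eq (z := a + b - k + 1) (n := a + b - k + 1) (by omega),
    zfact_of_eq (z := a + b + c - r - s - k + 1) (n := a + b + c - (r + s) - k + 1) (by omega)]
  rw [Finset.mul_sum, Finset.sum_div, Finset.mul_sum, Finset.sum_mul, Finset.mul_sum]
  refine Finset.sum_congr rfl fun i hi => ?_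
  exact T₂_term_eq_whipple_term hrb hrc hsa hs hka hkb hkN hc
    (Nat.lt_succ_iff.1 (Finset.mem_range.1 hi))

/-! ### The polynomial identity -/

/-- Partial sums of the telescoping sum behind `inverse_pair_orthogonality`. -/
theorem inverse_pair_partial_sum (d e t : ℕ) (ht : t ≤ d) :
    (d : ℂ) * ∑ i ∈ Finset.range t, (-1 : ℂ) ^ i * ((2 * d + e - 2 * i : ℕ) + 1 : ℂ) *
      (d + e - i)! / ((d - i)! * i ! * (2 * d + e - i + 1)!) =
    -(-1) ^ t * t * (d + e - t + 1)! / ((d - t)! * t ! * (2 * d + e - t + 1)!) := by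
  induction t with
  | zero => simp
  | succ t ih =>
    rw [Finset.sum_range_succ, mul_add, ih (by omega)]
    obtain ⟨j, rfl⟩ := Nat.exists_eq_add_of_le ht
    have e1 : t + 1 + j - t = j + 1 := by omega
    have e2 : t + 1 + j - (t + 1) = j := by omega
    have e3 : t + 1 + j + e - t + 1 = j + e + 1 + 1 := by omega
    have e4 : t + 1 + j + e - t = j + e + 1 := by omega
    have e5 : t + 1 + j + e - (t + 1) + 1 = j + e + 1 := by omega
    have e6 : 2 * (t + 1 + j) + e - t + 1 = t + 2 + 2 * j + e + 1 := by omega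
    have e7 : 2 * (t + 1 + j) + e - (t + 1) + 1 = t + 2 + 2 * j + e := by omega
    have e8 : 2 * (t + 1 + j) + e - 2 * t = 2 * j + e + 2 := by omega
    rw [e1, e2, e3, e4, e5, e6, e7, e8]
    rw [Nat.factorial_succ j, Nat.factorial_succ (j + e + 1), Nat.factorial_succ t,
      Nat.factorial_succ (t + 2 + 2 * j + e)]
    have f1 := factorial_cast_ne_zero j
    have f2 := factorial_cast_ne_zero t
    have f3 := factorial_cast_ne_zero (t + 2 + 2 * j + e)
    have f4 : (j : ℂ) + 1 ≠ 0 := Nat.cast_add_one_ne_zero j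
    have f5 : (t : ℂ) + 1 ≠ 0 := Nat.cast_add_one_ne_zero t
    have f6 : (t : ℂ) + 2 + 2 * j + e + 1 ≠ 0 := by
      exact_mod_cast Nat.cast_add_one_ne_zero (R := ℂ) (t + 2 + 2 * j + e)
    push_cast
    generalize ((j ! : ℕ) : ℂ) = J at *
    generalize ((t ! : ℕ) : ℂ) = T at *
    generalize (((t + 2 + 2 * j + e)! : ℕ) : ℂ) = F at *
    generalize (((j + e + 1)! : ℕ) : ℂ) = G at *
    rw [pow_succ]
    obtain ⟨W, hW⟩ : ∃ W : ℂ, W = (t : ℂ) + 2 + 2 * j + e + 1 := ⟨_, rfl⟩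
    rw [← hW] at f6 ⊢
    field_simp
    rw [hW]
    ring

/-- The products of the two matrices in `inverse_pair`, with indices shifted so that the diagonal
entry is at `0`. -/
theorem inverse_pair_orthogonality (d M : ℕ) (h : 2 * d ≤ M) :
    ∑ i ∈ Finset.range (d + 1), (-1 : ℂ) ^ i * ((M - 2 * i : ℕ) + 1 : ℂ) *
      (M - d - i)! / ((d - i)! * i ! * (M - i + 1)!) = if d = 0 then 1 else 0 := by
  obtain ⟨e, rfl⟩ := Nat.exists_eq_add_of_le h
  have e1 : 2 * d + e - d = d + e := by omega
  rw [e1]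
  split_ifs with hd
  · subst hd
    have f1 := factorial_cast_ne_zero e
    have f2 : (e : ℂ) + 1 ≠ 0 := Nat.cast_add_one_ne_zero e
    simp [Nat.factorial_succ]
    exact ⟨f2, e.factorial_ne_zero⟩
  · have hd' : (d : ℂ) ≠ 0 := Nat.cast_ne_zero.2 hd
    refine (mul_eq_zero.1 ?_).resolve_left hd'
    rw [Finset.sum_range_succ, mul_add, inverse_pair_partial_sum d e d le_rfl]
    have e2 : d + e - d = e := by omega
    have e3 : 2 * d + e - 2 * d = e := by omega
    rw [e2, e3, Nat.factorial_succ e]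
    push_cast
    ring

/-- The triangular matrices `(N - k - p)! / (p - k)!` and
`(-1) ^ (k - m) (N - 2k + 1) / ((k - m)! (N - k - m + 1)!)` are inverse to each other in the range
where all factorials make sense. -/
theorem inverse_pair (N p : ℕ) (hp : 2 * p ≤ N) (x : ℕ → ℂ) :
    ∑ k ∈ Finset.range (p + 1), ((N - k - p)! / (p - k)! : ℂ) *
      ∑ m ∈ Finset.range (k + 1), (-1 : ℂ) ^ (k - m) * ((N - 2 * k : ℕ) + 1 : ℂ) /
        ((k - m)! * (N - k - m + 1)!) * x m = x p := by
  simp_rw [Finset.mul_sum]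
  rw [sum_triangle, Finset.sum_eq_single p]
  · simp only [Nat.sub_self, zero_add, Finset.sum_range_one, Nat.add_zero, pow_zero,
      Nat.factorial_zero, Nat.cast_one, one_mul, div_one]
    have e1 : N - p - p = N - 2 * p := by omega
    rw [e1, Nat.factorial_succ]
    have f1 := factorial_cast_ne_zero (N - 2 * p)
    have f2 : ((N - 2 * p : ℕ) : ℂ) + 1 ≠ 0 := Nat.cast_add_one_ne_zero _
    push_cast
    field_simp
  · intro m hm hmp
    have hm' := Finset.mem_range.1 hm
    have h := inverse_pair_orthogonality (p - m) (N - 2 * m) (by omega)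
    rw [if_neg (by omega)] at h
    rw [← zero_mul (x m), ← h, Finset.sum_mul]
    refine Finset.sum_congr rfl fun j hj => ?_
    have := Finset.mem_range.1 hj
    have e1 : N - 2 * m - 2 * j = N - 2 * (m + j) := by omega
    have e2 : N - 2 * m - (p - m) - j = N - (m + j) - p := by omega
    have e3 : p - m - j = p - (m + j) := by omega
    have e4 : N - 2 * m - j + 1 = N - (m + j) - m + 1 := by omega
    have e5 : m + j - m = j := by omega
    rw [e1, e2, e3, e4, e5]
    have f1 := factorial_cast_ne_zero (p - (m + j))
    have f2 := factorial_cast_ne_zero j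
    have f3 := factorial_cast_ne_zero (N - (m + j) - m + 1)
    field_simp
  · intro h
    exact absurd (Finset.mem_range.2 (Nat.lt_succ_self p)) h

/-- Coefficient of `u ^ p * w ^ (n - p)` in the expansion of `((A, B)_k, C)_(n - k)` for powers of
linear forms, up to a common monomial, where `u = [αβ] γ` and `w = [βγ] α`. -/
noncomputable def rightCoeff (a b n k p : ℕ) : ℂ :=
  if k ≤ p then ((a - k).choose (p - k) : ℂ) * ((a + b - k - p).choose (n - p) : ℂ) /
    ((a + b - 2 * k).choose (n - k) : ℂ) else 0

theorem rightCoeff_eq {a b n k p : ℕ} (hkp : k ≤ p) (hpa : p ≤ a) (hpn : p ≤ n)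
    (hN : p + n ≤ a + b) :
    rightCoeff a b n k p * ((a - p)! * (n - p)!) = ((a + b - k - p)! / (p - k)! : ℂ) *
      ((a - k)! * (n - k)! / (a + b - 2 * k)!) := by
  rw [rightCoeff, if_pos hkp, Nat.cast_choose ℂ (show p - k ≤ a - k by omega),
    Nat.cast_choose ℂ (show n - p ≤ a + b - k - p by omega),
    Nat.cast_choose ℂ (show n - k ≤ a + b - 2 * k by omega)]
  have e1 : a - k - (p - k) = a - p := by omega
  have e2 : a + b - k - p - (n - p) = a + b - k - n := by omega
  have e3 : a + b - 2 * k - (n - k) = a + b - k - n := by omega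
  rw [e1, e2, e3]
  have f1 := factorial_cast_ne_zero (p - k)
  have f2 := factorial_cast_ne_zero (a - p)
  have f3 := factorial_cast_ne_zero (n - p)
  have f4 := factorial_cast_ne_zero (a + b - k - n)
  have f5 := factorial_cast_ne_zero (n - k)
  have f6 := factorial_cast_ne_zero (a + b - 2 * k)
  field_simp

/-- The coefficient identity in the range where the triangular system can be inverted. -/
theorem leftCoeff_eq_sum_of_le {a b c r s p : ℕ} (hrb : r ≤ b) (hrc : r ≤ c) (hsa : s ≤ a)
    (hs : s ≤ b + c - 2 * r) (hpa : p ≤ a) (hpb : p ≤ b) (hpn : p ≤ r + s)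
    (hpN : p + (r + s) ≤ a + b) :
    leftCoeff b c r s p = ∑ k ∈ Finset.range (r + s + 1),
      θ a b c r s k * rightCoeff a b (r + s) k p := by
  have f1 := factorial_cast_ne_zero (a - p)
  have f2 := factorial_cast_ne_zero (r + s - p)
  have hsub : ∑ k ∈ Finset.range (r + s + 1), θ a b c r s k * rightCoeff a b (r + s) k p =
      ∑ k ∈ Finset.range (p + 1), θ a b c r s k * rightCoeff a b (r + s) k p := by
    refine (Finset.sum_subset (Finset.range_subset_range.2 (by omega)) fun k _ hk => ?_).symm
    rw [Finset.mem_range] at hk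
    rw [rightCoeff, if_neg (by omega), mul_zero]
  rw [hsub]
  refine mul_right_cancel₀ (mul_ne_zero f1 f2) ?_
  rw [← inverse_pair (a + b) p (by omega) fun m => leftCoeff b c r s m * ((a - m)! * (r + s - m)!),
    Finset.sum_mul]
  refine Finset.sum_congr rfl fun k hk => ?_
  have := Finset.mem_range.1 hk
  rw [← θ_eq_sum_leftCoeff hrb hrc hsa hs (by omega) (by omega) (by omega) (by omega),
    mul_assoc, rightCoeff_eq (by omega) hpa hpn hpN]
  ring

/-- Expansion of a bilinear Vandermonde-type sum after substituting `v = u + w`. -/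
theorem sum_choose_mul_add_pow {R : Type*} [CommRing R] (p q l : ℕ) (u w : R) :
    ∑ j ∈ Finset.range (l + 1), (p.choose j : R) * (q.choose (l - j) : R) *
      ((u + w) ^ j * w ^ (l - j)) =
    ∑ m ∈ Finset.range (l + 1), (p.choose m : R) * ((p + q - m).choose (l - m) : R) *
      (u ^ m * w ^ (l - m)) := by
  simp_rw [add_pow, Finset.sum_mul, Finset.mul_sum]
  rw [sum_triangle]
  refine Finset.sum_congr rfl fun m _ => ?_
  trans ∑ i ∈ Finset.range (l - m + 1), (p.choose m : R) *
    (((p - m).choose i * q.choose (l - m - i) : ℕ) : R) * (u ^ m * w ^ (l - m))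
  · refine Finset.sum_congr rfl fun i hi => ?_
    have := Finset.mem_range.1 hi
    have e1 : l - (m + i) = l - m - i := by omega
    have e2 : l - m = i + (l - m - i) := by omega
    have e3 : m + i - m = i := by omega
    have hc : (p.choose (m + i) : R) * ((m + i).choose m : R) =
        (p.choose m : R) * ((p - m).choose i : R) := by
      have h := Nat.choose_mul (n := p) (k := m + i) (s := m)
      rw [e3] at h
      simpa using congrArg (Nat.cast (R := R)) (h (by omega))
    have hw : w ^ (l - m) = w ^ i * w ^ (l - m - i) := by rw [← pow_add, ← e2]
    rw [e1, e3, hw]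
    push_cast
    linear_combination (q.choose (l - m - i) : R) * (u ^ m * w ^ i * w ^ (l - m - i)) * hc
  · rw [← Finset.sum_mul, ← Finset.mul_sum]
    congr 1
    rcases le_or_gt m p with hmp | hmp
    · have e : p + q - m = (p - m) + q := by omega
      rw [e, Nat.add_choose_eq, Finset.Nat.sum_antidiagonal_eq_sum_range_succ_mk, Nat.cast_sum]
    · rw [Nat.choose_eq_zero_of_lt hmp]
      simp

section Expansion

variable {R : Type*} [CommRing R] [Algebra ℂ R]

/-- The polynomial in `u = [αβ] γ` and `w = [βγ] α` (so that `u + w = [αγ] β`) to which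
`(α ^ a, (β ^ b, γ ^ c)_r)_s` reduces. -/
noncomputable def leftPoly (b c r s : ℕ) (u w : R) : R :=
  w ^ r * ∑ j ∈ Finset.range (s + 1),
    (((b - r).choose j : ℂ) * ((c - r).choose (s - j) : ℂ) / ((b + c - 2 * r).choose s : ℂ)) •
      (u ^ j * (u + w) ^ (s - j))

/-- The polynomial in `u = [αβ] γ` and `w = [βγ] α` (so that `u + w = [αγ] β`) to which
`((α ^ a, β ^ b)_k, γ ^ c)_(n - k)` reduces. -/
noncomputable def rightPoly (a b n k : ℕ) (u w : R) : R :=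
  u ^ k * ∑ j ∈ Finset.range (n - k + 1),
    (((a - k).choose j : ℂ) * ((b - k).choose (n - k - j) : ℂ) /
      ((a + b - 2 * k).choose (n - k) : ℂ)) • ((u + w) ^ j * w ^ (n - k - j))

theorem natCast_mul_div_smul (x y : ℕ) (z : ℂ) (t : R) :
    ((x : ℂ) * y / z) • t = z⁻¹ • ((x : R) * (y : R) * t) := by
  rw [div_eq_inv_mul, mul_smul, mul_smul, Nat.cast_smul_eq_nsmul, Nat.cast_smul_eq_nsmul,
    nsmul_eq_mul, nsmul_eq_mul, mul_assoc]

/-- The expansion of `leftPoly` in the monomials `u ^ p * w ^ (r + s - p)`. -/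
theorem leftPoly_eq {b c r s : ℕ} (hrb : r ≤ b) (hrc : r ≤ c) (hs : s ≤ b + c - 2 * r) (u w : R) :
    leftPoly b c r s u w =
      ∑ p ∈ Finset.range (r + s + 1), leftCoeff b c r s p • (u ^ p * w ^ (r + s - p)) := by
  have hsub : ∑ p ∈ Finset.range (r + s + 1), leftCoeff b c r s p • (u ^ p * w ^ (r + s - p)) =
      ∑ p ∈ Finset.range (s + 1), leftCoeff b c r s p • (u ^ p * w ^ (r + s - p)) := by
    refine (Finset.sum_subset (Finset.range_subset_range.2 (by omega)) fun p _ hp => ?_).symm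
    rw [Finset.mem_range] at hp
    rw [leftCoeff, if_neg (by omega), zero_smul]
  have e : ∑ j ∈ Finset.range (s + 1), ((b - r).choose j : R) * ((c - r).choose (s - j) : R) *
      (u ^ j * (u + w) ^ (s - j)) = ∑ j ∈ Finset.range (s + 1),
        ((c - r).choose j : R) * ((b - r).choose (s - j) : R) * ((w + u) ^ j * u ^ (s - j)) := by
    rw [← Finset.sum_range_reflect]
    refine Finset.sum_congr rfl fun j hj => ?_
    have := Finset.mem_range.1 hj
    have e1 : s - (s + 1 - 1 - j) = j := by omega
    have e2 : s + 1 - 1 - j = s - j := by omega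
    rw [e1, e2]
    ring
  rw [hsub, leftPoly]
  simp_rw [natCast_mul_div_smul]
  rw [← Finset.smul_sum, e, sum_choose_mul_add_pow, ← Finset.sum_range_reflect, Finset.smul_sum,
    Finset.mul_sum]
  refine Finset.sum_congr rfl fun p hp => ?_
  have := Finset.mem_range.1 hp
  have e1 : s - (s - p) = p := by omega
  have e2 : s + 1 - 1 - p = s - p := by omega
  have e3 : c - r + (b - r) - (s - p) = b + c - 2 * r - s + p := by omega
  have e4 : r + s - p = r + (s - p) := by omega
  rw [leftCoeff, if_pos (by omega), natCast_mul_div_smul, mul_smul_comm, e2, e1, e3, e4, pow_add]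
  congr 1
  ring

/-- The expansion of `rightPoly` in the monomials `u ^ p * w ^ (n - p)`. -/
theorem rightPoly_eq {a b n k : ℕ} (hka : k ≤ a) (hkb : k ≤ b) (hkn : k ≤ n) (u w : R) :
    rightPoly a b n k u w =
      ∑ p ∈ Finset.range (n + 1), rightCoeff a b n k p • (u ^ p * w ^ (n - p)) := by
  have e : n + 1 = k + (n - k + 1) := by omega
  rw [rightPoly, e, Finset.sum_range_add (m := n - k + 1) (n := k),
    Finset.sum_eq_zero (s := Finset.range k), zero_add]
  · simp_rw [natCast_mul_div_smul]
    rw [← Finset.smul_sum, sum_choose_mul_add_pow, Finset.smul_sum, Finset.mul_sum]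
    refine Finset.sum_congr rfl fun m hm => ?_
    have := Finset.mem_range.1 hm
    have e1 : k + m - k = m := by omega
    have e2 : a + b - k - (k + m) = a - k + (b - k) - m := by omega
    have e3 : n - (k + m) = n - k - m := by omega
    rw [rightCoeff, if_pos (by omega), natCast_mul_div_smul, mul_smul_comm, e1, e2, e3, pow_add]
    congr 1
    ring
  · intro p hp
    rw [Finset.mem_range] at hp
    rw [rightCoeff, if_neg (by omega), zero_smul]

/-- `leftPoly` vanishes to order at least `r + s - b` along `u + w = 0`. -/
theorem add_pow_dvd_leftPoly {b c r s : ℕ} (hrb : r ≤ b) (u w : R) :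
    (u + w) ^ (r + s - b) ∣ leftPoly b c r s u w := by
  refine Dvd.dvd.mul_left (Finset.dvd_sum fun j hj => ?_) _
  rcases le_or_gt j (b - r) with h | h
  · rw [← mul_smul_comm]
    refine Dvd.dvd.mul_left ?_ _
    rw [← mul_one ((u + w) ^ (s - j)), ← mul_smul_comm]
    exact Dvd.dvd.mul_right (pow_dvd_pow _ (by omega)) _
  · rw [Nat.choose_eq_zero_of_lt h]
    simp

/-- `rightPoly` vanishes to order at least `n - b` along `u + w = 0`. -/
theorem add_pow_dvd_rightPoly {a b n k : ℕ} (hkb : k ≤ b) (u w : R) :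
    (u + w) ^ (n - b) ∣ rightPoly a b n k u w := by
  refine Dvd.dvd.mul_left (Finset.dvd_sum fun j hj => ?_) _
  have := Finset.mem_range.1 hj
  rcases le_or_gt (n - k - j) (b - k) with h | h
  · rw [← mul_smul_comm]
    exact Dvd.dvd.mul_right (pow_dvd_pow _ (by omega)) _
  · rw [Nat.choose_eq_zero_of_lt h]
    simp

end Expansion

theorem bounds_of_θ_ne_zero {a b c r s k : ℕ} (h : θ a b c r s k ≠ 0) :
    r + s ≤ c + k ∧ k ≤ a ∧ k ≤ b ∧ k ≤ r + s ∧ k + (r + s) ≤ a + b := by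
  rw [θ] at h
  have := (ite_ne_right_iff.1 h).1
  omega

/-- The expansion `leftPoly = ∑ θ_k rightPoly`, coefficient by coefficient. -/
theorem leftCoeff_eq_sum {a b c r s p : ℕ} (hrb : r ≤ b) (hrc : r ≤ c) (hsa : s ≤ a)
    (hs : s ≤ b + c - 2 * r) (hpn : p ≤ r + s) :
    leftCoeff b c r s p = ∑ k ∈ Finset.range (r + s + 1),
      θ a b c r s k * rightCoeff a b (r + s) k p := by
  let d : ℕ → ℂ := fun p => leftCoeff b c r s p - ∑ k ∈ Finset.range (r + s + 1),
      θ a b c r s k * rightCoeff a b (r + s) k p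
  -- the difference of both sides at `u = X`, `w = 1`
  let D : Polynomial ℂ := ∑ p ∈ Finset.range (r + s + 1), d p • (Polynomial.X ^ p * 1 ^ (r + s - p))
  have hcoeff : ∀ p, D.coeff p = if p ≤ r + s then d p else 0 := by
    intro p
    simp only [D, one_pow, mul_one, Polynomial.finsetSum_coeff, Polynomial.coeff_smul,
      Polynomial.coeff_X_pow, smul_eq_mul, mul_ite, mul_zero]
    rw [Finset.sum_ite_eq]
    simp
  have hD : D = leftPoly b c r s Polynomial.X 1 - ∑ k ∈ Finset.range (r + s + 1),
      θ a b c r s k • rightPoly a b (r + s) k Polynomial.X 1 := by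
    have h2 : ∑ k ∈ Finset.range (r + s + 1),
        θ a b c r s k • rightPoly a b (r + s) k (Polynomial.X : Polynomial ℂ) 1 =
        ∑ k ∈ Finset.range (r + s + 1), ∑ p ∈ Finset.range (r + s + 1),
          (θ a b c r s k * rightCoeff a b (r + s) k p) •
            (Polynomial.X ^ p * 1 ^ (r + s - p) : Polynomial ℂ) := by
      refine Finset.sum_congr rfl fun k hk => ?_
      by_cases hθ : θ a b c r s k = 0
      · simp [hθ]
      · obtain ⟨_, h1, h2, h3, _⟩ := bounds_of_θ_ne_zero hθ
        rw [rightPoly_eq h1 h2 h3, Finset.smul_sum]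
        simp_rw [mul_smul]
    rw [h2, Finset.sum_comm, leftPoly_eq hrb hrc hs, ← Finset.sum_sub_distrib]
    refine Finset.sum_congr rfl fun p _ => ?_
    rw [← Finset.sum_smul, ← sub_smul]
  -- `K` is the largest `k` for which `θ_k` can be nonzero.
  set K := min (min a b) (min (r + s) (a + b - (r + s))) with hK
  have hlow : ∀ p ≤ K, d p = 0 := by
    intro p hp
    exact sub_eq_zero.2 (leftCoeff_eq_sum_of_le hrb hrc hsa hs (by omega) (by omega) (by omega)
      (by omega))
  have hhigh : ∀ p, a < p → d p = 0 := by
    intro p hp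
    refine sub_eq_zero.2 ?_
    rw [leftCoeff, if_neg (by omega)]
    symm
    refine Finset.sum_eq_zero fun k _ => ?_
    by_cases hθ : θ a b c r s k = 0
    · rw [hθ, zero_mul]
    · obtain ⟨_, h1, h2, h3, _⟩ := bounds_of_θ_ne_zero hθ
      rw [rightCoeff, Nat.choose_eq_zero_of_lt (show a - k < p - k by omega)]
      simp
  have hdvd1 : (Polynomial.X : Polynomial ℂ) ^ (K + 1) ∣ D := by
    rw [Polynomial.X_pow_dvd_iff]
    intro p hp
    rw [hcoeff, hlow p (by omega), ite_self]
  have hdvd2 : (Polynomial.X + 1 : Polynomial ℂ) ^ (r + s - b) ∣ D := by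
    rw [hD]
    refine dvd_sub (add_pow_dvd_leftPoly hrb _ _) (Finset.dvd_sum fun k _ => ?_)
    by_cases hθ : θ a b c r s k = 0
    · simp [hθ]
    · obtain ⟨_, h1, h2, h3, _⟩ := bounds_of_θ_ne_zero hθ
      rw [← mul_one (rightPoly _ _ _ _ _ _), ← mul_smul_comm]
      exact Dvd.dvd.mul_right (add_pow_dvd_rightPoly h2 _ _) _
  have hcop : IsCoprime (Polynomial.X : Polynomial ℂ) (Polynomial.X + 1) := ⟨-1, 1, by ring⟩
  have hdvd := (hcop.pow (m := K + 1) (n := r + s - b)).mul_dvd hdvd1 hdvd2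
  have hD0 : D = 0 := by
    by_contra hne
    have hdeg := Polynomial.natDegree_le_of_dvd hdvd hne
    have hX1 : (Polynomial.X + 1 : Polynomial ℂ) = Polynomial.X + Polynomial.C 1 := by simp
    rw [hX1, Polynomial.natDegree_mul (pow_ne_zero _ Polynomial.X_ne_zero)
      (pow_ne_zero _ (Polynomial.X_add_C_ne_zero 1)), Polynomial.natDegree_pow,
      Polynomial.natDegree_pow, Polynomial.natDegree_X, Polynomial.natDegree_X_add_C] at hdeg
    have hdeg2 : D.natDegree ≤ min a (r + s) := by
      refine Polynomial.natDegree_le_iff_coeff_eq_zero.2 fun p hp => ?_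
      rw [hcoeff]
      split_ifs with h
      · exact hhigh p (by omega)
      · rfl
    omega
  have := hcoeff p
  rw [hD0, if_pos hpn, Polynomial.coeff_zero] at this
  exact sub_eq_zero.1 this.symm

theorem leftPoly_eq_sum_rightPoly {R : Type*} [CommRing R] [Algebra ℂ R] {a b c r s : ℕ}
    (hrb : r ≤ b) (hrc : r ≤ c) (hsa : s ≤ a) (hs : s ≤ b + c - 2 * r) (u w : R) :
    leftPoly b c r s u w = ∑ k ∈ Finset.range (r + s + 1),
      θ a b c r s k • rightPoly a b (r + s) k u w := by
  rw [leftPoly_eq hrb hrc hs]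
  have h2 : ∑ k ∈ Finset.range (r + s + 1), θ a b c r s k • rightPoly a b (r + s) k u w =
      ∑ k ∈ Finset.range (r + s + 1), ∑ p ∈ Finset.range (r + s + 1),
        (θ a b c r s k * rightCoeff a b (r + s) k p) • (u ^ p * w ^ (r + s - p)) := by
    refine Finset.sum_congr rfl fun k hk => ?_
    by_cases hθ : θ a b c r s k = 0
    · simp [hθ]
    · obtain ⟨_, h1, h2, h3, _⟩ := bounds_of_θ_ne_zero hθ
      rw [rightPoly_eq h1 h2 h3, Finset.smul_sum]
      simp_rw [mul_smul]
  rw [h2, Finset.sum_comm]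
  refine Finset.sum_congr rfl fun p hp => ?_
  rw [← Finset.sum_smul, ← leftCoeff_eq_sum hrb hrc hsa hs
    (Nat.lt_succ_iff.1 (Finset.mem_range.1 hp))]

/-! ### Transvectants of powers of linear forms -/

/-- The linear form `x₁ + t x₂`. -/
noncomputable def lin (t : ℂ) : MvPolynomial (Fin 2) ℂ := X 0 + C t * X 1

/-- The derivation `t ∂/∂x₁ - ∂/∂x₂`, which kills `lin t`. -/
noncomputable def dir (t : ℂ) :
    Derivation ℂ (MvPolynomial (Fin 2) ℂ) (MvPolynomial (Fin 2) ℂ) :=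
  t • pderiv 0 - pderiv 1

theorem pderiv_zero_lin (t : ℂ) : pderiv 0 (lin t) = 1 := by
  simp [lin]

theorem pderiv_one_lin (t : ℂ) : pderiv 1 (lin t) = C t := by
  simp [lin]

theorem dir_lin (t l : ℂ) : dir t (lin l) = C (t - l) := by
  simp [dir, pderiv_zero_lin, pderiv_one_lin, smul_eq_C_mul]

theorem lin_ne_zero (t : ℂ) : lin t ≠ 0 := by
  intro h
  have := congrArg (eval ![1, 0]) h
  simp [lin] at this

theorem iterate_derivation_smul {R A : Type*} [CommRing R] [CommRing A] [Algebra R A]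
    (D : Derivation R A A) (z : R) (f : A) (n : ℕ) : D^[n] (z • f) = z • D^[n] f :=
  (Function.Semiconj.iterate_right (f := fun f => z • f) (fun f => (D.map_smul z f).symm) n f).symm

theorem iterate_derivation_pow {R A : Type*} [CommRing R] [CommRing A] [Algebra R A]
    (D : Derivation R A A) (f : A) (t : R) (hf : D f = algebraMap R A t) (n j : ℕ) :
    D^[j] (f ^ n) = ((n.descFactorial j : R) * t ^ j) • f ^ (n - j) := by
  induction j with
  | zero => simp
  | succ j ih =>
    rw [Function.iterate_succ_apply', ih, D.map_smul, D.leibniz_pow, hf, Nat.descFactorial_succ,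
      Nat.sub_sub]
    simp only [Algebra.smul_def (R := R) (A := A), nsmul_eq_mul, smul_eq_mul, map_mul, map_pow,
      map_natCast, Nat.cast_mul]
    ring

/-- The iterated Leibniz rule. -/
theorem iterate_derivation_mul {R A : Type*} [CommRing R] [CommRing A] [Algebra R A]
    (D : Derivation R A A) (f g : A) (l : ℕ) :
    D^[l] (f * g) =
      ∑ ij ∈ Finset.HasAntidiagonal.antidiagonal l, l.choose ij.1 • (D^[ij.1] f * D^[ij.2] g) := by
  induction l with
  | zero => simp
  | succ l ih =>
    rw [Function.iterate_succ_apply', ih, map_sum,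
      Finset.sum_antidiagonal_choose_succ_nsmul (fun i j => D^[i] f * D^[j] g),
      ← Finset.sum_add_distrib]
    refine Finset.sum_congr rfl fun ij hij => ?_
    rw [Nat.choose_symm_of_eq_add (Finset.HasAntidiagonal.mem_antidiagonal.1 hij).symm,
      map_nsmul, D.leibniz,
      ← smul_add, Function.iterate_succ_apply', Function.iterate_succ_apply', smul_eq_mul,
      smul_eq_mul, mul_comm (D^[ij.2] g)]

/-- `mixedDeriv` as a product of powers in the algebra of endomorphisms. -/
theorem mixedDeriv_eq (i j : ℕ) (A : MvPolynomial (Fin 2) ℂ) :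
    mixedDeriv i j A =
      (((pderiv (R := ℂ) (0 : Fin 2)).toLinearMap ^ i *
        (pderiv (R := ℂ) (1 : Fin 2)).toLinearMap ^ j :
          Module.End ℂ (MvPolynomial (Fin 2) ℂ))) A := by
  rw [Module.End.mul_apply, Module.End.pow_apply, Module.End.pow_apply]
  rfl

theorem commute_pderiv (i j : Fin 2) :
    Commute ((pderiv (R := ℂ) i).toLinearMap : Module.End ℂ (MvPolynomial (Fin 2) ℂ))
      (pderiv (R := ℂ) j).toLinearMap := by
  have h : ⁅pderiv (R := ℂ) i, pderiv (R := ℂ) j⁆ = 0 := by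
    refine MvPolynomial.derivation_ext fun l => ?_
    rw [Derivation.commutator_apply, pderiv_X, pderiv_X]
    simp [Pi.single_apply, apply_ite]
  refine LinearMap.ext fun p => ?_
  have := DFunLike.congr_fun h p
  rw [Derivation.commutator_apply, Derivation.zero_apply, sub_eq_zero] at this
  exact this

theorem mixedDeriv_lin_pow (i j n : ℕ) (t : ℂ) :
    mixedDeriv i j (lin t ^ n) =
      ((n.descFactorial (i + j) : ℂ) * t ^ j) • lin t ^ (n - (i + j)) := by
  rw [mixedDeriv, iterate_derivation_pow (pderiv 1) (lin t) t (pderiv_one_lin t)]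
  rw [iterate_derivation_smul, iterate_derivation_pow (pderiv 0) (lin t) 1
    (by rw [pderiv_zero_lin, map_one]), smul_smul,
    Nat.sub_sub, add_comm i j,
    ← Nat.descFactorial_mul_descFactorial (n := n) (Nat.le_add_right j i), Nat.add_sub_cancel_left]
  push_cast
  congr 1
  ring

theorem iterate_dir_eq_sum (t : ℂ) (r : ℕ) (A : MvPolynomial (Fin 2) ℂ) :
    (dir t)^[r] A = ∑ i ∈ Finset.range (r + 1),
      ((-1 : ℂ) ^ i * (r.choose i : ℂ) * t ^ (r - i)) • mixedDeriv (r - i) i A := by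
  have hD : (dir t)^[r] A = ((dir t).toLinearMap ^ r : Module.End ℂ _) A := by
    rw [Module.End.pow_apply]
    rfl
  have hd : (dir t).toLinearMap = -(pderiv (R := ℂ) (1 : Fin 2)).toLinearMap +
      t • (pderiv (R := ℂ) (0 : Fin 2)).toLinearMap := by
    ext p
    simp [dir]
    ring
  rw [hD, hd, Commute.add_pow (((commute_pderiv 1 0).neg_left).smul_right t), LinearMap.sum_apply]
  refine Finset.sum_congr rfl fun i _ => ?_
  rw [mixedDeriv_eq, neg_pow, smul_pow]
  have h1 : (-1 : Module.End ℂ (MvPolynomial (Fin 2) ℂ)) ^ i = ((-1 : ℂ) ^ i) • 1 := by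
    rw [← neg_one_smul ℂ (1 : Module.End ℂ (MvPolynomial (Fin 2) ℂ)), smul_pow, one_pow]
  have h2 : ((r.choose i : ℕ) : Module.End ℂ (MvPolynomial (Fin 2) ℂ)) =
      (r.choose i : ℂ) • 1 := by
    rw [Nat.cast_smul_eq_nsmul, nsmul_one]
  rw [h1, h2, ((commute_pderiv 0 1).pow_pow (r - i) i).eq]
  simp only [smul_mul_assoc, one_mul, mul_smul_comm, mul_one, smul_smul, LinearMap.smul_apply]
  congr 1
  ring

/-- Transvection with a power of `x₁ + t x₂` is differentiation along `dir t`. -/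
theorem transvectant_lin_pow_right {m n r : ℕ} (hr : r ≤ n) (t : ℂ)
    (A : MvPolynomial (Fin 2) ℂ) :
    transvectant m n r A (lin t ^ n) =
      ((m - r)! / m ! : ℂ) • (lin t ^ (n - r) * (dir t)^[r] A) := by
  rw [transvectant, iterate_dir_eq_sum, Finset.mul_sum, Finset.smul_sum, Finset.smul_sum]
  refine Finset.sum_congr rfl fun i hi => ?_
  have hi' : i ≤ r := Nat.lt_succ_iff.1 (Finset.mem_range.1 hi)
  rw [mixedDeriv_lin_pow, Nat.add_sub_cancel' hi', ← Nat.factorial_mul_descFactorial hr]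
  simp only [mul_smul_comm, smul_mul_assoc, smul_smul, mul_comm (lin t ^ (n - r))]
  congr 1
  have f1 := factorial_cast_ne_zero m
  have f2 := factorial_cast_ne_zero (n - r)
  have f3 : ((n.descFactorial r : ℕ) : ℂ) ≠ 0 :=
    Nat.cast_ne_zero.2 (by rw [Ne, Nat.descFactorial_eq_zero_iff_lt]; omega)
  push_cast
  field_simp

theorem transvectant_lin_pow_left {m n r : ℕ} (hr : r ≤ m) (t : ℂ)
    (B : MvPolynomial (Fin 2) ℂ) :
    transvectant m n r (lin t ^ m) B =
      ((-1) ^ r * ((n - r)! / n ! : ℂ)) • (lin t ^ (m - r) * (dir t)^[r] B) := by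
  rw [transvectant, iterate_dir_eq_sum, Finset.mul_sum, Finset.smul_sum, Finset.smul_sum,
    ← Finset.sum_range_reflect]
  refine Finset.sum_congr rfl fun i hi => ?_
  have hi' : i ≤ r := Nat.lt_succ_iff.1 (Finset.mem_range.1 hi)
  have e1 : r + 1 - 1 - i = r - i := by omega
  have e2 : r - (r - i) = i := by omega
  rw [e1, e2, mixedDeriv_lin_pow, Nat.add_sub_cancel' hi', ← Nat.factorial_mul_descFactorial hr,
    Nat.choose_symm hi']
  simp only [mul_smul_comm, smul_mul_assoc, smul_smul]
  congr 1
  have f1 := factorial_cast_ne_zero n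
  have f2 := factorial_cast_ne_zero (m - r)
  have f3 : ((m.descFactorial r : ℕ) : ℂ) ≠ 0 :=
    Nat.cast_ne_zero.2 (by rw [Ne, Nat.descFactorial_eq_zero_iff_lt]; omega)
  obtain ⟨j, rfl⟩ := Nat.exists_eq_add_of_le hi'
  have e3 : i + j - i = j := by omega
  have s1 : ((-1 : ℂ) ^ i * (-1) ^ i) = 1 := by rw [← mul_pow]; norm_num
  rw [e3, pow_add]
  push_cast
  generalize (-1 : ℂ) ^ i = x at *
  field_simp
  linear_combination (-((n - (i + j))! : ℂ) * (i + j).choose i * t ^ j) * s1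

theorem transvectant_lin_pow_lin_pow {a b k : ℕ} (hka : k ≤ a) (hkb : k ≤ b) (l m : ℂ) :
    transvectant a b k (lin l ^ a) (lin m ^ b) =
      (m - l) ^ k • (lin l ^ (a - k) * lin m ^ (b - k)) := by
  rw [transvectant_lin_pow_right hkb, iterate_derivation_pow (dir m) (lin l) (m - l) (dir_lin m l),
    ← Nat.factorial_mul_descFactorial hka, mul_smul_comm, smul_smul, mul_comm (lin m ^ _)]
  congr 1
  have f2 := factorial_cast_ne_zero (a - k)
  have f3 : ((a.descFactorial k : ℕ) : ℂ) ≠ 0 :=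
    Nat.cast_ne_zero.2 (by rw [Ne, Nat.descFactorial_eq_zero_iff_lt]; omega)
  push_cast
  field_simp

theorem iterate_dir_lin_pow_mul {p q l : ℕ} (hl : l ≤ p + q) (t x y : ℂ) :
    ((p + q - l)! / (p + q)! : ℂ) • (dir t)^[l] (lin x ^ p * lin y ^ q) =
      ∑ j ∈ Finset.range (l + 1),
        ((p.choose j : ℂ) * (q.choose (l - j) : ℂ) / ((p + q).choose l : ℂ)) •
          ((t - x) ^ j * (t - y) ^ (l - j)) • (lin x ^ (p - j) * lin y ^ (q - (l - j))) := by
  rw [iterate_derivation_mul, Finset.Nat.sum_antidiagonal_eq_sum_range_succ_mk, Finset.smul_sum]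
  refine Finset.sum_congr rfl fun j hj => ?_
  have hj' : j ≤ l := Nat.lt_succ_iff.1 (Finset.mem_range.1 hj)
  dsimp only
  rw [iterate_derivation_pow (dir t) (lin x) (t - x) (dir_lin t x),
    iterate_derivation_pow (dir t) (lin y) (t - y) (dir_lin t y), ← Nat.cast_smul_eq_nsmul ℂ]
  simp only [mul_smul_comm, smul_mul_assoc, smul_smul]
  congr 1
  rw [Nat.cast_choose ℂ hj', Nat.cast_choose ℂ hl, Nat.descFactorial_eq_factorial_mul_choose,
    Nat.descFactorial_eq_factorial_mul_choose]
  have f1 := factorial_cast_ne_zero j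
  have f2 := factorial_cast_ne_zero (l - j)
  have f3 := factorial_cast_ne_zero l
  have f4 := factorial_cast_ne_zero (p + q)
  have f5 := factorial_cast_ne_zero (p + q - l)
  push_cast
  field_simp

/-- The iterated transvectant on the left, for powers of linear forms, is a monomial times
`leftPoly`. The factor `(αβγ) ^ (r + s)` avoids negative exponents. -/
theorem left_transvectant_lin_pow {a b c r s : ℕ} (hrb : r ≤ b) (hrc : r ≤ c) (hsa : s ≤ a)
    (hs : s ≤ b + c - 2 * r) (l m n : ℂ) :
    (lin l * lin m * lin n) ^ (r + s) * transvectant a (b + c - 2 * r) s (lin l ^ a)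
      (transvectant b c r (lin m ^ b) (lin n ^ c)) =
    lin l ^ a * lin m ^ b * lin n ^ c *
      leftPoly b c r s (C (m - l) * lin n) (C (n - m) * lin l) := by
  -- the Plücker relation
  have huw : C (m - l) * lin n + C (n - m) * lin l = C (n - l) * lin m := by
    simp only [lin, C_sub]
    ring
  have e : b + c - 2 * r = b - r + (c - r) := by omega
  rw [leftPoly, huw, transvectant_lin_pow_lin_pow hrb hrc, transvectant_lin_pow_left hsa,
    iterate_derivation_smul]
  have h := iterate_dir_lin_pow_mul (p := b - r) (q := c - r) (l := s) (by omega) l m n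
  rw [← e] at h
  have hscal : ((-1 : ℂ) ^ s * ((b + c - 2 * r - s)! / (b + c - 2 * r)!)) •
      (lin l ^ (a - s) * ((n - m) ^ r • (dir l)^[s] (lin m ^ (b - r) * lin n ^ (c - r)))) =
      ((-1 : ℂ) ^ s * (n - m) ^ r) • (lin l ^ (a - s) *
        (((b + c - 2 * r - s)! / (b + c - 2 * r)! : ℂ) •
          (dir l)^[s] (lin m ^ (b - r) * lin n ^ (c - r)))) := by
    simp only [mul_smul_comm, smul_smul]
    congr 1
    ring
  rw [hscal, h]
  simp only [Finset.mul_sum, Finset.smul_sum]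
  refine Finset.sum_congr rfl fun j hj => ?_
  have hj' : j ≤ s := Nat.lt_succ_iff.1 (Finset.mem_range.1 hj)
  by_cases hjb : j ≤ b - r
  swap
  · rw [Nat.choose_eq_zero_of_lt (show b - r < j by omega)]
    simp
  by_cases hjc : s - j ≤ c - r
  swap
  · rw [Nat.choose_eq_zero_of_lt (show c - r < s - j by omega)]
    simp
  simp only [C_mul', smul_pow, smul_mul_assoc, mul_smul_comm, smul_smul]
  have hsign : (-1 : ℂ) ^ s * ((l - m) ^ j * (l - n) ^ (s - j)) =
      (m - l) ^ j * (n - l) ^ (s - j) := by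
    rw [← neg_sub l m, ← neg_sub l n, neg_pow (l - m), neg_pow (l - n)]
    have : (-1 : ℂ) ^ s = (-1) ^ j * (-1) ^ (s - j) := by rw [← pow_add, Nat.add_sub_cancel' hj']
    rw [this]
    ring
  congr 1
  · linear_combination (n - m) ^ r * (((b - r).choose j : ℂ) * ((c - r).choose (s - j) : ℂ) /
      ((b + c - 2 * r).choose s : ℂ)) * hsign
  · obtain ⟨i, rfl⟩ := Nat.exists_eq_add_of_le hj'
    obtain ⟨a', rfl⟩ := Nat.exists_eq_add_of_le hsa
    obtain ⟨b', rfl⟩ := Nat.exists_eq_add_of_le (show r + j ≤ b by omega)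
    obtain ⟨c', rfl⟩ := Nat.exists_eq_add_of_le (show r + i ≤ c by omega)
    have e1 : j + i - j = i := by omega
    have e2 : r + j + b' - r - j = b' := by omega
    have e3 : r + i + c' - r - i = c' := by omega
    have e4 : j + i + a' - (j + i) = a' := by omega
    rw [e1, e2, e3, e4]
    ring

/-- The iterated transvectant on the right, for powers of linear forms, is a monomial times
`rightPoly`. -/
theorem right_transvectant_lin_pow {a b c d k : ℕ} (hka : k ≤ a) (hkb : k ≤ b) (hkd : k ≤ d)
    (hdc : d ≤ c + k) (hd : k + d ≤ a + b) (l m n : ℂ) :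
    (lin l * lin m * lin n) ^ d * transvectant (a + b - 2 * k) c (d - k)
      (transvectant a b k (lin l ^ a) (lin m ^ b)) (lin n ^ c) =
    lin l ^ a * lin m ^ b * lin n ^ c *
      rightPoly a b d k (C (m - l) * lin n) (C (n - m) * lin l) := by
  -- the Plücker relation
  have huw : C (m - l) * lin n + C (n - m) * lin l = C (n - l) * lin m := by
    simp only [lin, C_sub]
    ring
  have e : a + b - 2 * k = a - k + (b - k) := by omega
  rw [rightPoly, huw, transvectant_lin_pow_lin_pow hka hkb,
    transvectant_lin_pow_right (by omega), iterate_derivation_smul]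
  have h := iterate_dir_lin_pow_mul (p := a - k) (q := b - k) (l := d - k) (by omega) n l m
  rw [← e] at h
  have hscal : ((a + b - 2 * k - (d - k))! / (a + b - 2 * k)! : ℂ) • (lin n ^ (c - (d - k)) *
      ((m - l) ^ k • (dir n)^[d - k] (lin l ^ (a - k) * lin m ^ (b - k)))) =
      (m - l) ^ k • (lin n ^ (c - (d - k)) *
        (((a + b - 2 * k - (d - k))! / (a + b - 2 * k)! : ℂ) •
          (dir n)^[d - k] (lin l ^ (a - k) * lin m ^ (b - k)))) := by
    simp only [mul_smul_comm, smul_smul, mul_comm]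
  rw [hscal, h]
  simp only [Finset.mul_sum, Finset.smul_sum]
  refine Finset.sum_congr rfl fun j hj => ?_
  have hj' : j ≤ d - k := Nat.lt_succ_iff.1 (Finset.mem_range.1 hj)
  by_cases hja : j ≤ a - k
  swap
  · rw [Nat.choose_eq_zero_of_lt (show a - k < j by omega)]
    simp
  by_cases hjb : d - k - j ≤ b - k
  swap
  · rw [Nat.choose_eq_zero_of_lt (show b - k < d - k - j by omega)]
    simp
  simp only [C_mul', smul_pow, smul_mul_assoc, mul_smul_comm, smul_smul]
  congr 1
  · ring
  · obtain ⟨i, rfl⟩ := Nat.exists_eq_add_of_le (show k + j ≤ d by omega)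
    obtain ⟨a', rfl⟩ := Nat.exists_eq_add_of_le (show k + j ≤ a by omega)
    obtain ⟨b', rfl⟩ := Nat.exists_eq_add_of_le (show k + i ≤ b by omega)
    obtain ⟨c', rfl⟩ := Nat.exists_eq_add_of_le (show j + i ≤ c by omega)
    have e1 : k + j + i - k = j + i := by omega
    have e2 : j + i - j = i := by omega
    have e3 : k + j + a' - k - j = a' := by omega
    have e4 : k + i + b' - k - i = b' := by omega
    have e5 : j + i + c' - (j + i) = c' := by omega
    rw [e1, e2, e3, e4, e5]
    ring

/-! ### Reduction to powers of linear forms -/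

/-- The transvectant as a bilinear map. -/
noncomputable def transvectantHom (m n r : ℕ) : MvPolynomial (Fin 2) ℂ →ₗ[ℂ]
    MvPolynomial (Fin 2) ℂ →ₗ[ℂ] MvPolynomial (Fin 2) ℂ :=
  (((m - r)! : ℂ) * ((n - r)! : ℂ) / ((m ! : ℂ) * (n ! : ℂ))) •
    ∑ i ∈ Finset.range (r + 1), ((-1 : ℂ) ^ i * (r.choose i : ℂ)) •
      (LinearMap.mul ℂ (MvPolynomial (Fin 2) ℂ)).compl₁₂
        ((pderiv (R := ℂ) (0 : Fin 2)).toLinearMap ^ (r - i) *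
          (pderiv (R := ℂ) (1 : Fin 2)).toLinearMap ^ i)
        ((pderiv (R := ℂ) (0 : Fin 2)).toLinearMap ^ i *
          (pderiv (R := ℂ) (1 : Fin 2)).toLinearMap ^ (r - i))

theorem transvectantHom_apply (m n r : ℕ) (A B : MvPolynomial (Fin 2) ℂ) :
    transvectantHom m n r A B = transvectant m n r A B := by
  simp only [transvectantHom, transvectant, mixedDeriv_eq, LinearMap.smul_apply,
    LinearMap.sum_apply, LinearMap.compl₁₂_apply, LinearMap.mul_apply']

/-- The values of a vector-valued polynomial function span its coefficients. -/
theorem coeff_mem_of_forall_sum_pow_smul_mem {K V : Type*} [Field K] [Infinite K] [AddCommGroup V]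
    [Module K V] (W : Submodule K V) (v : ℕ → V) (n : ℕ)
    (h : ∀ t : K, ∑ j ∈ Finset.range (n + 1), t ^ j • v j ∈ W) {j : ℕ} (hj : j ≤ n) : v j ∈ W := by
  by_contra hv
  obtain ⟨f, hf, hW⟩ := Submodule.exists_le_ker_of_notMem hv
  have hp : ∑ i ∈ Finset.range (n + 1), Polynomial.C (f (v i)) * Polynomial.X ^ i = 0 := by
    refine Polynomial.funext fun t => ?_
    have := LinearMap.mem_ker.1 (hW (h t))
    rw [map_sum] at this
    simp only [map_smul, smul_eq_mul] at this
    simp only [Polynomial.eval_finsetSum, Polynomial.eval_mul, Polynomial.eval_C,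
      Polynomial.eval_pow, Polynomial.eval_X, Polynomial.eval_zero]
    rw [← this]
    exact Finset.sum_congr rfl fun i _ => mul_comm _ _
  have := congrArg (fun p => Polynomial.coeff p j) hp
  simp only [Polynomial.finsetSum_coeff, Polynomial.coeff_C_mul, Polynomial.coeff_X_pow, mul_ite,
    mul_one, mul_zero, Polynomial.coeff_zero] at this
  rw [Finset.sum_ite_eq, if_pos (Finset.mem_range.2 (by omega))] at this
  exact hf this

/-- Binary forms of order `m` are linear combinations of `m`-th powers of linear forms. -/
theorem Form.mem_span {m : ℕ} {A : MvPolynomial (Fin 2) ℂ} (hA : Form m A) :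
    A ∈ Submodule.span ℂ (Set.range fun t => lin t ^ m) := by
  have hmon : ∀ j ≤ m, (X 0 ^ (m - j) * X 1 ^ j : MvPolynomial (Fin 2) ℂ) ∈
      Submodule.span ℂ (Set.range fun t => lin t ^ m) := by
    intro j hj
    have := coeff_mem_of_forall_sum_pow_smul_mem (K := ℂ)
      (Submodule.span ℂ (Set.range fun t => lin t ^ m))
      (fun j => (m.choose j : ℂ) • (X 0 ^ (m - j) * X 1 ^ j : MvPolynomial (Fin 2) ℂ)) m
      (fun t => by
        refine Set.mem_of_eq_of_mem ?_ (Submodule.subset_span ⟨t, rfl⟩)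
        dsimp only
        rw [lin, add_comm (X 0), add_pow]
        refine Finset.sum_congr rfl fun i _ => ?_
        rw [C_mul', smul_pow, smul_smul, smul_mul_assoc, smul_mul_assoc, mul_smul,
          Nat.cast_smul_eq_nsmul, nsmul_eq_mul]
        congr 1
        ring) hj
    have hne : (m.choose j : ℂ) ≠ 0 := Nat.cast_ne_zero.2 (Nat.choose_pos hj).ne'
    simpa [hne] using Submodule.smul_mem _ (m.choose j : ℂ)⁻¹ this
  rw [A.as_sum]
  refine Submodule.sum_mem _ fun d hd => ?_
  have hdeg : d 0 + d 1 = m := by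
    have := hA (mem_support_iff.1 hd)
    rw [Finsupp.weight_apply, Finsupp.sum_fintype _ _ (by simp)] at this
    simpa using this
  have : monomial d (coeff d A) = coeff d A • (X 0 ^ (m - d 1) * X 1 ^ d 1) := by
    rw [monomial_eq, C_mul', Finsupp.prod_fintype _ _ (by simp), Fin.prod_univ_two]
    have : m - d 1 = d 0 := by omega
    rw [this]
  rw [this]
  exact Submodule.smul_mem _ _ (hmon _ (by omega))

/-- The recoupling formula for powers of linear forms. -/
theorem recoupling_lin_pow {a b c r s : ℕ} (hrb : r ≤ b) (hrc : r ≤ c) (hsa : s ≤ a)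
    (hs : s ≤ b + c - 2 * r) (l m n : ℂ) :
    transvectant a (b + c - 2 * r) s (lin l ^ a) (transvectant b c r (lin m ^ b) (lin n ^ c)) =
      ∑ k ∈ Finset.range (r + s + 1), θ a b c r s k •
        transvectant (a + b - 2 * k) c (r + s - k)
          (transvectant a b k (lin l ^ a) (lin m ^ b)) (lin n ^ c) := by
  have hne : (lin l * lin m * lin n) ^ (r + s) ≠ 0 :=
    pow_ne_zero _ (mul_ne_zero (mul_ne_zero (lin_ne_zero l) (lin_ne_zero m)) (lin_ne_zero n))
  refine mul_left_cancel₀ hne ?_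
  rw [left_transvectant_lin_pow hrb hrc hsa hs, leftPoly_eq_sum_rightPoly hrb hrc hsa hs,
    Finset.mul_sum, Finset.mul_sum]
  refine Finset.sum_congr rfl fun k _ => ?_
  by_cases hθ : θ a b c r s k = 0
  · simp [hθ]
  · obtain ⟨h0, h1, h2, h3, h4⟩ := bounds_of_θ_ne_zero hθ
    rw [mul_smul_comm, mul_smul_comm, right_transvectant_lin_pow h1 h2 h3 h0 h4]

theorem recoupling_sum {a b c r s : ℕ} {A B C : MvPolynomial (Fin 2) ℂ} (hA : Form a A)
    (hB : Form b B) (hC : Form c C) (hrb : r ≤ b) (hrc : r ≤ c) (hsa : s ≤ a)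
    (hs : s ≤ b + c - 2 * r) :
    transvectant a (b + c - 2 * r) s A (transvectant b c r B C) =
      ∑ k ∈ Finset.range (r + s + 1), θ a b c r s k •
        transvectant (a + b - 2 * k) c (r + s - k) (transvectant a b k A B) C := by
  -- Both sides are linear in each of the three forms.
  have hC' : ∀ l m : ℂ, transvectant a (b + c - 2 * r) s (lin l ^ a)
        (transvectant b c r (lin m ^ b) C) =
      ∑ k ∈ Finset.range (r + s + 1), θ a b c r s k •
        transvectant (a + b - 2 * k) c (r + s - k)
          (transvectant a b k (lin l ^ a) (lin m ^ b)) C := by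
    intro l m
    have := LinearMap.eqOn_span
      (f := transvectantHom a (b + c - 2 * r) s (lin l ^ a) ∘ₗ transvectantHom b c r (lin m ^ b))
      (g := ∑ k ∈ Finset.range (r + s + 1), θ a b c r s k •
        transvectantHom (a + b - 2 * k) c (r + s - k)
          (transvectantHom a b k (lin l ^ a) (lin m ^ b)))
      (s := Set.range fun t => lin t ^ c)
      (by
        rintro _ ⟨n, rfl⟩
        simpa [LinearMap.sum_apply, transvectantHom_apply] using
          recoupling_lin_pow hrb hrc hsa hs l m n) hC.mem_span
    simpa [LinearMap.sum_apply, transvectantHom_apply] using this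
  have hB' : ∀ l : ℂ, transvectant a (b + c - 2 * r) s (lin l ^ a) (transvectant b c r B C) =
      ∑ k ∈ Finset.range (r + s + 1), θ a b c r s k •
        transvectant (a + b - 2 * k) c (r + s - k) (transvectant a b k (lin l ^ a) B) C := by
    intro l
    have := LinearMap.eqOn_span
      (f := transvectantHom a (b + c - 2 * r) s (lin l ^ a) ∘ₗ (transvectantHom b c r).flip C)
      (g := ∑ k ∈ Finset.range (r + s + 1), θ a b c r s k •
        ((transvectantHom (a + b - 2 * k) c (r + s - k)).flip C ∘ₗ
          transvectantHom a b k (lin l ^ a)))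
      (s := Set.range fun t => lin t ^ b)
      (by
        rintro _ ⟨m, rfl⟩
        simpa [LinearMap.sum_apply, transvectantHom_apply] using hC' l m) hB.mem_span
    simpa [LinearMap.sum_apply, transvectantHom_apply] using this
  have := LinearMap.eqOn_span
    (f := (transvectantHom a (b + c - 2 * r) s).flip (transvectantHom b c r B C))
    (g := ∑ k ∈ Finset.range (r + s + 1), θ a b c r s k •
      ((transvectantHom (a + b - 2 * k) c (r + s - k)).flip C ∘ₗ (transvectantHom a b k).flip B))
    (s := Set.range fun t => lin t ^ a)
    (by
      rintro _ ⟨l, rfl⟩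
      simpa [LinearMap.sum_apply, transvectantHom_apply] using hB' l) hA.mem_span
  simpa [LinearMap.sum_apply, transvectantHom_apply] using this

end BinaryForm

/-- Recoupling formula for transvectants. Since `θ_k` is zero unless
`max 0 (r + s - c) ≤ k ≤ min a b`, `k ≤ r + s` and `r + s - k ≤ a + b - 2k`, all natural-number
subtractions and all conversions `k.toNat` in the nonzero terms are exact, and the sum over
`k : ℤ` has only finitely many nonzero terms. -/
theorem theorem7p1 (a b c r s : ℕ) (A B C : MvPolynomial (Fin 2) ℂ)
    (hA : BinaryForm.Form a A) (hB : BinaryForm.Form b B) (hC : BinaryForm.Form c C)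
    (hrb : r ≤ b) (hrc : r ≤ c) (hsa : s ≤ a) (hs : s ≤ b + c - 2 * r) :
    BinaryForm.transvectant a (b + c - 2 * r) s A (BinaryForm.transvectant b c r B C) =
      ∑ᶠ k : ℤ, BinaryForm.θ a b c r s k •
        BinaryForm.transvectant (a + b - 2 * k.toNat) c (r + s - k.toNat)
          (BinaryForm.transvectant a b k.toNat A B) C := by
  rw [BinaryForm.recoupling_sum hA hB hC hrb hrc hsa hs,
    finsum_eq_sum_of_support_subset (s := (Finset.range (r + s + 1)).map Nat.castEmbedding),
    Finset.sum_map]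
  · simp
  · intro k hk
    have hθ : BinaryForm.θ a b c r s k ≠ 0 := left_ne_zero_of_smul (Function.mem_support.1 hk)
    rw [BinaryForm.θ] at hθ
    have := (ite_ne_right_iff.1 hθ).1
    simp only [Finset.coe_map, Set.mem_image, Finset.coe_range, Set.mem_Iio]
    exact ⟨k.toNat, by omega, by simp; omega⟩
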